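/- Let $A$ be a unital C$^*$-algebra, $B \subset A$ a C$^*$-subalgebra containing $1_A$, and $E : A \to B$ a conditional expectation. Let $L^2(A,E)$ be the Hilbert $B$-module obtained from $A$ by separation and completion with respect to $\langle a, b\rangle = E(a^*b)$, with left action $\pi_E$ of $A$ by left multiplication, and regard $X = L^2(A,E)\otimes_B A$ (interior tensor product, $A$ being the Hilbert $A$-module with $\langle x,y\rangle = x^*y$ and left multiplication by $B$) as a C$^*$-correspondence over $A$ with left action $\pi_X = \pi_E\otimes 1$. The triple $(A,B,E)$ is called nuclear if $X$ has the universal factorization property: for every C$^*$-algebra $C$ and every nondegenerate $*$-representation $\sigma : A\otimes_{\max} C\to \mathbb B(H)$, with associated commuting representations $\sigma_A$ of $A$ and $\sigma_C$ of $C$ satisfying $\sigma(a\otimes c)=\sigma_A(a)\sigma_C(c)$, the kernel of the representation $$\phi_X^H : A\otimes_{\max} C\to \mathbb B(X\otimes_{\sigma_A} H),\qquad a\otimes c\mapsto \pi_X(a)\otimes\sigma_C(c),$$ is contained in the kernel of $\sigma$ (equivalently, $\sigma$ factors through the image of $\phi_X^H$). Then $(A,B,E)$ is nuclear if and only if for every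 finite subset $\mathfrak F\subset A$ and every $\varepsilon>0$ there exist $n,m\in\mathbb N$ and completely positive maps $\varphi_k : A\to \mathbb M_n(B)$ and $\psi_k:\mathbb M_n(B)\to A$, $1\le k\le m$, such that $\|a-\sum_{k=1}^m\psi_k\circ\varphi_k(a)\|<\varepsilon$ for all $a\in\mathfrak F$, and such that for each $k$ there are $x_1,\dots,x_n,y_1,\dots,y_n\in A$ (depending on $k$) with $$\varphi_k(a)=\bigl[E(x_i^*ax_j)\bigr]_{i,j=1}^n\quad(a\in A),\qquad \psi_k\bigl([b_{ij}]_{i,j=1}^n\bigr)=\sum_{i,j=1}^n y_i^*b_{ij}y_j\quad([b_{ij}]\in\mathbb M_n(B)).$$ -/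

import Mathlib

open scoped ComplexOrder TensorProduct ENNReal CStarAlgebra
open MulOpposite (op)

universe u

namespace RelNuc

universe v w


/-! ### Hilbert C⋆-modules -/

/-- A (right) Hilbert C⋆-module over a unital C⋆-algebra `B`, with inner product conjugate linear
in the first variable. The right action of `b` on `x` is `op b • x`. Definiteness of the inner
product is contained in `norm_eq`. -/
structure HilbertModule (B : Type v) [CStarAlgebra B] [PartialOrder B] where
  carrier : Type w
  [normedAddCommGroup : NormedAddCommGroup carrier]
  [normedSpace : NormedSpace ℂ carrier]
  [completeSpace : CompleteSpace carrier]
  [module : Module Bᵐᵒᵖ carrier]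
  [isScalarTower : IsScalarTower ℂ Bᵐᵒᵖ carrier]
  [smulCommClass : SMulCommClass ℂ Bᵐᵒᵖ carrier]
  ip : carrier →ₗ⋆[ℂ] carrier →ₗ[ℂ] B
  ip_smul : ∀ (x y : carrier) (b : B), ip x (op b • y) = ip x y * b
  star_ip : ∀ x y : carrier, star (ip x y) = ip y x
  ip_nonneg : ∀ x : carrier, 0 ≤ ip x x
  norm_eq : ∀ x : carrier, ‖x‖ = √‖ip x x‖

attribute [instance] HilbertModule.normedAddCommGroup HilbertModule.normedSpace
  HilbertModule.completeSpace HilbertModule.module HilbertModule.isScalarTower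
  HilbertModule.smulCommClass

/-- An `A`-`B` C⋆-correspondence: a Hilbert `B`-module with a `*`-homomorphism `left` from `A` to
the adjointable operators (`left (star a)` is the adjoint of `left a`). -/
structure Corr (A : Type u) (B : Type v) [CStarAlgebra A] [CStarAlgebra B] [PartialOrder B]
    extends HilbertModule.{v, w} B where
  left : A →ₙₐ[ℂ] (carrier →L[ℂ] carrier)
  left_adj : ∀ (a : A) (x y : carrier), ip (left (star a) x) y = ip x (left a y)

/-! ### Separation and completion of a semi-inner product -/

/-- A `B`-valued semi-inner product on a complex vector space `V` with a right action of `B`. The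
laws of the action are not needed here: they hold in the separated completion because of
`ip_ract`. -/
structure SemiIP (B : Type v) (V : Type w) [CStarAlgebra B] [PartialOrder B] [AddCommGroup V]
    [Module ℂ V] where
  ip : V →ₗ⋆[ℂ] V →ₗ[ℂ] B
  ract : B → V → V
  ip_ract : ∀ (x y : V) (b : B), ip x (ract b y) = ip x y * b
  star_ip : ∀ x y : V, star (ip x y) = ip y x
  nonneg : ∀ x : V, 0 ≤ ip x x

namespace SemiIP

variable {B : Type v} {V : Type w} [CStarAlgebra B] [PartialOrder B] [StarOrderedRing B]
  [AddCommGroup V] [Module ℂ V] (S : SemiIP B V)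

theorem ip_ract_left (x y : V) (b : B) : S.ip (S.ract b x) y = star b * S.ip x y := by
  rw [← S.star_ip, S.ip_ract, star_mul, S.star_ip]

theorem star_mul_le (x y : V) (t : ℝ) (ht : ‖S.ip x x‖ < t) :
    star (S.ip x y) * S.ip x y ≤ t • S.ip y y := by
  have ht0 : 0 < t := (norm_nonneg _).trans_lt ht
  set a := S.ip x y with ha
  have h1 := S.nonneg (S.ract a x - (t : ℂ) • y)
  have h2 : S.ip (S.ract a x - (t : ℂ) • y) (S.ract a x - (t : ℂ) • y)
      = star a * S.ip x x * a - t • (star a * a) - t • (star a * a) + t • t • S.ip y y := by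
    have hyx : S.ip y x = star a := by rw [ha, S.star_ip]
    simp only [map_sub, LinearMap.sub_apply, LinearMap.map_smulₛₗ, LinearMap.smul_apply,
      S.ip_ract, S.ip_ract_left, hyx, ← ha]
    simp only [Complex.conj_ofReal, RingHom.id_apply, Complex.coe_smul, smul_sub]
    abel
  rw [h2] at h1
  have h3 : star a * S.ip x x * a ≤ t • (star a * a) :=
    (CStarAlgebra.star_left_conjugate_le_norm_smul (IsSelfAdjoint.of_nonneg (S.nonneg x))).trans
      (smul_le_smul_of_nonneg_right ht.le (star_mul_self_nonneg a))
  have h4 : 0 ≤ t • (t • S.ip y y - star a * a) := by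
    refine h1.trans ?_
    rw [smul_sub]
    have := sub_le_sub_right (sub_le_sub_right h3 (t • (star a * a))) (t • (star a * a))
    calc _ ≤ t • (star a * a) - t • (star a * a) - t • (star a * a) + t • t • S.ip y y := by
          gcongr
      _ = _ := by abel
  have h5 : 0 ≤ t • S.ip y y - star a * a := by
    have := smul_nonneg (inv_nonneg.2 ht0.le) h4
    rwa [inv_smul_smul₀ ht0.ne'] at this
  exact sub_nonneg.1 h5

theorem norm_ip_le (x y : V) : ‖S.ip x y‖ ≤ √‖S.ip x x‖ * √‖S.ip y y‖ := by
  rw [← Real.sqrt_mul (norm_nonneg _)]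
  refine Real.le_sqrt_of_sq_le ?_
  rw [sq, ← CStarRing.norm_star_mul_self]
  have key : ∀ t : ℝ, ‖S.ip x x‖ < t → ‖star (S.ip x y) * S.ip x y‖ ≤ t * ‖S.ip y y‖ := by
    intro t ht
    have h := CStarAlgebra.norm_le_norm_of_nonneg_of_le (star_mul_self_nonneg _)
      (S.star_mul_le x y t ht)
    rwa [norm_smul, Real.norm_of_nonneg ((norm_nonneg _).trans ht.le)] at h
  refine ge_of_tendsto (x := nhdsWithin ‖S.ip x x‖ (Set.Ioi ‖S.ip x x‖))
    (f := fun t => t * ‖S.ip y y‖) ?_ (eventually_nhdsWithin_of_forall key)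
  exact ((continuous_id.mul continuous_const).tendsto _).mono_left nhdsWithin_le_nhds

/-- The vector space `V`, regarded as a seminormed space through the semi-inner product `S`. -/
@[nolint unusedArguments]
def Space (_ : SemiIP B V) : Type w := V

theorem norm_add_le' (x y : V) :
    √‖S.ip (x + y) (x + y)‖ ≤ √‖S.ip x x‖ + √‖S.ip y y‖ := by
  rw [Real.sqrt_le_left (by positivity)]
  have h1 := S.norm_ip_le x y
  have h2 := S.norm_ip_le y x
  have hx := Real.sq_sqrt (norm_nonneg (S.ip x x))
  have hy := Real.sq_sqrt (norm_nonneg (S.ip y y))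
  have h3 : ‖S.ip (x + y) (x + y)‖
      ≤ ‖S.ip x x‖ + ‖S.ip y x‖ + (‖S.ip x y‖ + ‖S.ip y y‖) := by
    simp only [map_add, LinearMap.add_apply]
    exact (norm_add_le _ _).trans (add_le_add (norm_add_le _ _) (norm_add_le _ _))
  nlinarith

/-- The seminorm `‖⟨x, x⟩‖ ^ (1/2)`. -/
noncomputable def seminorm : Seminorm ℂ V :=
  Seminorm.of (fun x => √‖S.ip x x‖) S.norm_add_le' (fun z x => by
    simp only [LinearMap.map_smulₛₗ, LinearMap.smul_apply, norm_smul, RingHom.id_apply,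
      RCLike.norm_conj]
    rw [← mul_assoc, Real.sqrt_mul (by positivity), Real.sqrt_mul_self (norm_nonneg _)])

noncomputable instance : SeminormedAddCommGroup S.Space :=
  AddGroupSeminorm.toSeminormedAddCommGroup (E := V) S.seminorm.toAddGroupSeminorm

noncomputable instance : NormedSpace ℂ S.Space where
  toModule := (inferInstance : Module ℂ V)
  norm_smul_le z x := (map_smul_eq_mul S.seminorm z x).le

/-- The separated completion of `V`. -/
abbrev Hat : Type w := UniformSpace.Completion S.Space

/-- The canonical map with dense range into the separated completion. -/
noncomputable def incl : V →ₗ[ℂ] S.Hat :=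
  (UniformSpace.Completion.toComplL (𝕜 := ℂ) (E := S.Space)).toLinearMap

theorem denseRange_incl : DenseRange S.incl :=
  UniformSpace.Completion.denseRange_coe (α := S.Space)

theorem norm_incl (x : V) : ‖S.incl x‖ = √‖S.ip x x‖ :=
  UniformSpace.Completion.norm_coe (E := S.Space) x

theorem norm_ip_le_incl (x y : V) : ‖S.ip x y‖ ≤ ‖S.incl x‖ * ‖S.incl y‖ := by
  rw [norm_incl, norm_incl]; exact S.norm_ip_le x y

theorem incl_eq_zero {z : V} (h : ∀ w, S.ip w z = 0) : S.incl z = 0 := by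
  rw [← norm_eq_zero, norm_incl, h]; simp

/-- The vector-valued form `⟨x, ·⟩` on the completion, for `x` in `V`. -/
noncomputable def ipAux : V →ₗ⋆[ℂ] (S.Hat →L[ℂ] B) where
  toFun x := (S.ip x).extendOfNorm S.incl
  map_add' x y := by
    refine LinearMap.extendOfNorm_unique S.denseRange_incl (‖S.incl (x + y)‖)
      (S.norm_ip_le_incl _) _ ?_
    ext z
    simp [LinearMap.extendOfNorm_eq S.denseRange_incl ⟨_, S.norm_ip_le_incl _⟩]
  map_smul' c x := by
    refine LinearMap.extendOfNorm_unique S.denseRange_incl (‖S.incl (c • x)‖)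
      (S.norm_ip_le_incl _) _ ?_
    ext z
    simp [LinearMap.extendOfNorm_eq S.denseRange_incl ⟨_, S.norm_ip_le_incl _⟩]

theorem ipAux_incl (x y : V) : S.ipAux x (S.incl y) = S.ip x y :=
  LinearMap.extendOfNorm_eq S.denseRange_incl ⟨_, S.norm_ip_le_incl _⟩ y

theorem norm_ipAux_le (x : V) : ‖S.ipAux x‖ ≤ 1 * ‖S.incl x‖ := by
  rw [one_mul]
  exact LinearMap.opNorm_extendOfNorm_le S.denseRange_incl (norm_nonneg _) (S.norm_ip_le_incl x)

/-- The inner product on the completion. -/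
noncomputable def ipHat : S.Hat →L⋆[ℂ] (S.Hat →L[ℂ] B) := S.ipAux.extendOfNorm S.incl

theorem ipHat_incl (x y : V) : S.ipHat (S.incl x) (S.incl y) = S.ip x y := by
  rw [ipHat, LinearMap.extendOfNorm_eq S.denseRange_incl ⟨_, S.norm_ipAux_le⟩, ipAux_incl]

theorem continuous_ipHat : Continuous fun p : S.Hat × S.Hat => S.ipHat p.1 p.2 := by
  fun_prop

theorem star_ipHat (x y : S.Hat) : star (S.ipHat x y) = S.ipHat y x := by
  refine S.denseRange_incl.induction_on₂ (p := fun x y => star (S.ipHat x y) = S.ipHat y x)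
    ?_ ?_ x y
  · exact isClosed_eq (continuous_star.comp S.continuous_ipHat)
      (S.continuous_ipHat.comp continuous_swap)
  · intro x y
    rw [ipHat_incl, ipHat_incl, S.star_ip]

theorem ipHat_nonneg (x : S.Hat) : 0 ≤ S.ipHat x x := by
  refine S.denseRange_incl.induction_on (p := fun x => 0 ≤ S.ipHat x x) x ?_ ?_
  · exact CStarAlgebra.isClosed_nonneg.preimage
      (S.continuous_ipHat.comp (continuous_id.prodMk continuous_id))
  · intro x
    rw [ipHat_incl]
    exact S.nonneg x

theorem norm_hat (x : S.Hat) : ‖x‖ = √‖S.ipHat x x‖ := by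
  refine S.denseRange_incl.induction_on (p := fun x => ‖x‖ = √‖S.ipHat x x‖) x ?_ ?_
  · exact isClosed_eq continuous_norm
      (S.continuous_ipHat.comp (continuous_id.prodMk continuous_id)).norm.sqrt
  · intro x
    rw [ipHat_incl, norm_incl]

theorem hat_ext {x y : S.Hat} (h : ∀ w, S.ipHat w x = S.ipHat w y) : x = y := by
  rw [← sub_eq_zero, ← norm_eq_zero, norm_hat, map_sub, h, sub_self]
  simp

/-- The right action of `b`, as a linear map from `V` to the completion. -/
noncomputable def ractAux (b : B) : V →ₗ[ℂ] S.Hat where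
  toFun x := S.incl (S.ract b x)
  map_add' x y := by
    rw [← sub_eq_zero, ← map_add, ← map_sub]
    refine S.incl_eq_zero fun w => ?_
    simp [S.ip_ract, add_mul]
  map_smul' c x := by
    rw [← sub_eq_zero, RingHom.id_apply, ← map_smul, ← map_sub]
    refine S.incl_eq_zero fun w => ?_
    simp [S.ip_ract]

theorem norm_ractAux_le (b : B) (x : V) : ‖S.ractAux b x‖ ≤ ‖b‖ * ‖S.incl x‖ := by
  change ‖S.incl (S.ract b x)‖ ≤ _
  rw [norm_incl, norm_incl, S.ip_ract, S.ip_ract_left]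
  refine Real.sqrt_le_iff.2 ⟨by positivity, ?_⟩
  rw [mul_pow, Real.sq_sqrt (norm_nonneg _)]
  calc ‖star b * S.ip x x * b‖ ≤ ‖star b‖ * ‖S.ip x x‖ * ‖b‖ :=
        (norm_mul_le _ _).trans (by gcongr; exact norm_mul_le _ _)
    _ = _ := by rw [norm_star]; ring

/-- The right action of `b` on the completion. -/
noncomputable def ractHat (b : B) : S.Hat →L[ℂ] S.Hat := (S.ractAux b).extendOfNorm S.incl

theorem ractHat_incl (b : B) (x : V) : S.ractHat b (S.incl x) = S.incl (S.ract b x) :=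
  LinearMap.extendOfNorm_eq S.denseRange_incl ⟨_, S.norm_ractAux_le b⟩ x

theorem ipHat_ractHat (b : B) (x y : S.Hat) :
    S.ipHat x (S.ractHat b y) = S.ipHat x y * b := by
  refine S.denseRange_incl.induction_on₂
    (p := fun x y => S.ipHat x (S.ractHat b y) = S.ipHat x y * b) ?_ ?_ x y
  · exact isClosed_eq (S.continuous_ipHat.comp
      (continuous_fst.prodMk ((S.ractHat b).continuous.comp continuous_snd)))
      (S.continuous_ipHat.mul continuous_const)
  · intro x y
    rw [ractHat_incl, ipHat_incl, ipHat_incl, S.ip_ract]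

/-- The right `B`-module structure of the completion. -/
@[reducible]
noncomputable def moduleHat : Module Bᵐᵒᵖ S.Hat where
  smul b x := S.ractHat b.unop x
  one_smul x := S.hat_ext fun w => by
    change S.ipHat w (S.ractHat 1 x) = _
    rw [ipHat_ractHat, mul_one]
  mul_smul b c x := S.hat_ext fun w => by
    change S.ipHat w (S.ractHat (c.unop * b.unop) x)
      = S.ipHat w (S.ractHat b.unop (S.ractHat c.unop x))
    simp only [ipHat_ractHat, mul_assoc]
  smul_zero b := map_zero (S.ractHat b.unop)
  smul_add b := map_add (S.ractHat b.unop)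
  add_smul b c x := S.hat_ext fun w => by
    change S.ipHat w (S.ractHat (b.unop + c.unop) x)
      = S.ipHat w (S.ractHat b.unop x + S.ractHat c.unop x)
    rw [map_add (S.ipHat w)]
    simp only [ipHat_ractHat, mul_add]
  zero_smul x := S.hat_ext fun w => by
    change S.ipHat w (S.ractHat 0 x) = _
    simp [ipHat_ractHat]

/-- The Hilbert module obtained from a semi-inner product by separation and completion. -/
noncomputable def hilbert : HilbertModule.{v, w} B :=
  letI := S.moduleHat
  { carrier := S.Hat
    isScalarTower := ⟨fun z b x => S.hat_ext fun w => by
      change S.ipHat w (S.ractHat (z • b.unop) x) = S.ipHat w (z • S.ractHat b.unop x)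
      simp [ipHat_ractHat]⟩
    smulCommClass := ⟨fun z b x => (map_smul (S.ractHat b.unop) z x).symm⟩
    ip := LinearMap.mk₂'ₛₗ (starRingEnd ℂ) (RingHom.id ℂ) (fun x y => S.ipHat x y)
      (fun x y z => by simp) (fun c x y => by simp) (fun x y z => by simp)
      (fun c x y => by simp)
    ip_smul := fun x y b => S.ipHat_ractHat b x y
    star_ip := S.star_ipHat
    ip_nonneg := S.ipHat_nonneg
    norm_eq := S.norm_hat }

/-! `*`-representations of a C⋆-algebra on a semi-inner product space extend to the completion. -/

section Rep

variable {D : Type*} [NonUnitalCStarAlgebra D] (ρ : D →ₙₐ[ℂ] Module.End ℂ V)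

theorem ip_rep_le
    (hρ : ∀ (d : D) (x y : V), S.ip (ρ (star d) x) y = S.ip x (ρ d y))
    (d : D) (x : V) :
    S.ip (ρ d x) (ρ d x) ≤ (‖d‖ ^ 2) • S.ip x x := by
  let _ := CStarAlgebra.spectralOrder (Unitization ℂ D)
  let _ := CStarAlgebra.spectralOrderedRing (Unitization ℂ D)
  let r : Unitization ℂ D →ₐ[ℂ] Module.End ℂ V := Unitization.lift ρ
  have hr : ∀ (e : Unitization ℂ D) (x y : V), S.ip (r (star e) x) y = S.ip x (r e y) := by
    intro e x y
    induction e using Unitization.ind with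
    | inl_add_inr z d =>
      simp [r, hρ]
  have hr' : ∀ (e : Unitization ℂ D) (x : V), S.ip (r e x) (r e x) = S.ip x (r (star e * e) x) := by
    intro e x
    rw [map_mul, Module.End.mul_apply, ← hr (star e), star_star]
  have hpos : 0 ≤ algebraMap ℝ (Unitization ℂ D) (‖(d : Unitization ℂ D)‖ ^ 2)
      - star (d : Unitization ℂ D) * d :=
    sub_nonneg.2 CStarAlgebra.star_mul_le_algebraMap_norm_sq
  obtain ⟨c, hc⟩ := CStarAlgebra.nonneg_iff_eq_star_mul_self.1 hpos
  have h := S.nonneg (r c x)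
  rw [hr', ← hc, map_sub, LinearMap.sub_apply, map_sub, ← hr', Algebra.algebraMap_eq_smul_one,
    ← Complex.coe_smul, map_smul, map_one, LinearMap.smul_apply, Module.End.one_apply, map_smul,
    Complex.coe_smul, Unitization.norm_inr] at h
  have hd : r (d : Unitization ℂ D) = ρ d := by simp [r]
  rw [hd] at h
  exact sub_nonneg.1 h

theorem norm_rep_le
    (hρ : ∀ (d : D) (x y : V), S.ip (ρ (star d) x) y = S.ip x (ρ d y))
    (d : D) (x : V) : ‖(S.incl ∘ₗ ρ d) x‖ ≤ ‖d‖ * ‖S.incl x‖ := by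
  rw [LinearMap.comp_apply, norm_incl, norm_incl]
  refine Real.sqrt_le_iff.2 ⟨by positivity, ?_⟩
  rw [mul_pow, Real.sq_sqrt (norm_nonneg _)]
  refine (CStarAlgebra.norm_le_norm_of_nonneg_of_le (S.nonneg _) (S.ip_rep_le ρ hρ d x)).trans ?_
  rw [norm_smul, Real.norm_of_nonneg (by positivity)]

/-- The operator on the completion that extends `ρ d`. -/
noncomputable def repAux (d : D) : S.Hat →L[ℂ] S.Hat := (S.incl ∘ₗ ρ d).extendOfNorm S.incl

theorem repAux_incl
    (hρ : ∀ (d : D) (x y : V), S.ip (ρ (star d) x) y = S.ip x (ρ d y))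
    (d : D) (x : V) : S.repAux ρ d (S.incl x) = S.incl (ρ d x) :=
  LinearMap.extendOfNorm_eq S.denseRange_incl ⟨_, S.norm_rep_le ρ hρ d⟩ x

theorem hat_op_ext {f g : S.Hat →L[ℂ] S.Hat} (h : ∀ x, f (S.incl x) = g (S.incl x)) : f = g :=
  ContinuousLinearMap.ext fun x => S.denseRange_incl.induction_on
    (p := fun x => f x = g x) x (isClosed_eq f.continuous g.continuous) h

variable (hρ : ∀ (d : D) (x y : V), S.ip (ρ (star d) x) y = S.ip x (ρ d y))

/-- The representation on the completion that extends `ρ`. -/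
noncomputable def rep : D →ₙₐ[ℂ] (S.Hat →L[ℂ] S.Hat) where
  toFun d := S.repAux ρ d
  map_smul' z d := S.hat_op_ext fun x => by simp [S.repAux_incl ρ hρ]
  map_zero' := S.hat_op_ext fun x => by simp [S.repAux_incl ρ hρ]
  map_add' d e := S.hat_op_ext fun x => by simp [S.repAux_incl ρ hρ]
  map_mul' d e := S.hat_op_ext fun x => by simp [S.repAux_incl ρ hρ]

theorem rep_incl (d : D) (x : V) : S.rep ρ hρ d (S.incl x) = S.incl (ρ d x) :=
  S.repAux_incl ρ hρ d x

theorem rep_adj (d : D) (x y : S.Hat) :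
    S.ipHat (S.rep ρ hρ (star d) x) y = S.ipHat x (S.rep ρ hρ d y) := by
  refine S.denseRange_incl.induction_on₂
    (p := fun x y => S.ipHat (S.rep ρ hρ (star d) x) y = S.ipHat x (S.rep ρ hρ d y)) ?_ ?_ x y
  · exact isClosed_eq (S.continuous_ipHat.comp
      (((S.rep ρ hρ (star d)).continuous.comp continuous_fst).prodMk continuous_snd))
      (S.continuous_ipHat.comp
        (continuous_fst.prodMk ((S.rep ρ hρ d).continuous.comp continuous_snd)))
  · intro x y
    rw [rep_incl, rep_incl, ipHat_incl, ipHat_incl, hρ]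

end Rep

/-- The correspondence obtained by separation and completion from a semi-inner product space on
which a C⋆-algebra `A` acts. -/
noncomputable def corr {A : Type u} [CStarAlgebra A] (ρ : A →ₙₐ[ℂ] Module.End ℂ V)
    (hρ : ∀ (a : A) (x y : V), S.ip (ρ (star a) x) y = S.ip x (ρ a y)) : Corr.{u, v, w} A B :=
  { S.hilbert with
    left := S.rep ρ hρ
    left_adj := S.rep_adj ρ hρ }

end SemiIP

/-! ### The interior tensor product -/

section Positivity

variable {A : Type u} [CStarAlgebra A] [PartialOrder A] [StarOrderedRing A]

theorem exists_eq_star_mul_self {a : A} (ha : 0 ≤ a) : ∃ b : A, a = star b * b :=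
  CStarAlgebra.nonneg_iff_eq_star_mul_self.1 ha

theorem exists_negPart (M : A) (hM : IsSelfAdjoint M) : ∃ N Q : A, star N = N ∧ N = star Q * Q ∧
    N * M * N = -(N * N * N) ∧ (N = 0 → 0 ≤ M) := by
  have hN0 : 0 ≤ M⁻ := CFC.negPart_nonneg M
  obtain ⟨Q, hQ⟩ := CStarAlgebra.nonneg_iff_eq_star_mul_self.1 hN0
  refine ⟨M⁻, Q, (IsSelfAdjoint.of_nonneg hN0).star_eq, hQ, ?_, fun h => ?_⟩
  · nth_rewrite 2 [← CFC.posPart_sub_negPart M hM]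
    rw [mul_sub, sub_mul, CFC.negPart_mul_posPart]
    simp
  · rw [← CFC.posPart_sub_negPart M hM, h, sub_zero]
    exact CFC.posPart_nonneg M

theorem matrix_nonneg {n : ℕ} (M : CStarMatrix (Fin n) (Fin n) A) (hM : IsSelfAdjoint M)
    (h : ∀ c : Fin n → A, 0 ≤ ∑ i, ∑ j, star (c i) * M i j * c j) : 0 ≤ M := by
  obtain ⟨N, Q, hNs, hQ, hMN, hfin⟩ := exists_negPart M hM
  have hRR : N * N * N = star (Q * N) * (Q * N) := by
    rw [star_mul, hNs, mul_assoc N (star Q), ← mul_assoc (star Q), ← hQ, ← mul_assoc]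
  have hR : Q * N = 0 := by
    have hdiag : ∀ k, ∑ i, star ((Q * N) i k) * (Q * N) i k ≤ 0 := by
      intro k
      have h1 := h fun i => N i k
      have h2 : ∑ i, ∑ j, star (N i k) * M i j * N j k = (N * M * N) k k := by
        rw [mul_assoc]
        simp only [CStarMatrix.mul_apply, Finset.mul_sum]
        refine Finset.sum_congr rfl fun i _ => Finset.sum_congr rfl fun j _ => ?_
        have : star (N i k) = N k i := by
          conv_rhs => rw [← hNs]
          rfl
        rw [this, mul_assoc]
      rw [h2, hMN, hRR] at h1
      have h3 : (star (Q * N) * (Q * N)) k k = ∑ i, star ((Q * N) i k) * (Q * N) i k := by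
        rw [CStarMatrix.mul_apply]; rfl
      rw [← h3]
      exact neg_nonneg.1 h1
    ext i k
    have h4 := (Finset.sum_eq_zero_iff_of_nonneg
      (fun i _ => star_mul_self_nonneg ((Q * N) i k))).1
      (le_antisymm (hdiag k) (Finset.sum_nonneg fun i _ => star_mul_self_nonneg _)) i
      (Finset.mem_univ i)
    exact CStarRing.star_mul_self_eq_zero_iff _ |>.1 h4
  have hNN : star N * N = 0 := by
    rw [hNs]
    nth_rewrite 1 [hQ]
    rw [mul_assoc, hR, mul_zero]
  exact hfin (CStarRing.star_mul_self_eq_zero_iff _ |>.1 hNN)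

end Positivity

namespace Corr

section Tensor

variable {A : Type*} {B : Type*} {C : Type*} [CStarAlgebra A] [CStarAlgebra B] [PartialOrder B]
  [StarOrderedRing B] [CStarAlgebra C] [PartialOrder C] [StarOrderedRing C]
  (X : Corr A B) (Y : Corr B C)

theorem gram_nonneg (X : HilbertModule B) {n : ℕ} (x : Fin n → X.carrier) :
    0 ≤ (CStarMatrix.ofMatrix (fun i j => X.ip (x i) (x j)) : CStarMatrix (Fin n) (Fin n) B) := by
  refine matrix_nonneg _ ?_ ?_
  · ext i j
    exact X.star_ip (x j) (x i)
  · intro c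
    have h := X.ip_nonneg (∑ i, op (c i) • x i)
    have hl : ∀ (b : B) (x y : X.carrier), X.ip (op b • x) y = star b * X.ip x y := by
      intro b x y
      rw [← X.star_ip, X.ip_smul, star_mul, X.star_ip]
    simp only [map_sum, LinearMap.sum_apply, X.ip_smul, hl] at h
    rw [Finset.sum_comm]
    exact h

/-- The sesquilinear form `⟨x ⊗ y, x' ⊗ y'⟩ = ⟨y, ⟨x, x'⟩ y'⟩` on the algebraic tensor product. -/
noncomputable def tensorIP :
    (X.carrier ⊗[ℂ] Y.carrier) →ₗ⋆[ℂ] (X.carrier ⊗[ℂ] Y.carrier) →ₗ[ℂ] C :=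
  TensorProduct.lift <| LinearMap.mk₂'ₛₗ (starRingEnd ℂ) (starRingEnd ℂ)
    (fun x y => TensorProduct.lift <| LinearMap.mk₂ ℂ (fun x' y' => Y.ip y (Y.left (X.ip x x') y'))
      (by simp) (by simp) (by simp) (by simp))
    (fun x₁ x₂ y => by ext; simp)
    (fun c x y => by ext; simp)
    (fun x y₁ y₂ => by ext; simp)
    (fun c x y => by ext; simp)

theorem tensorIP_tmul (x x' : X.carrier) (y y' : Y.carrier) :
    X.tensorIP Y (x ⊗ₜ y) (x' ⊗ₜ y') = Y.ip y (Y.left (X.ip x x') y') := rfl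

theorem tensorIP_nonneg (z : X.carrier ⊗[ℂ] Y.carrier) : 0 ≤ X.tensorIP Y z z := by
  obtain ⟨n, x, y, rfl⟩ : ∃ (n : ℕ) (x : Fin n → X.carrier) (y : Fin n → Y.carrier),
      z = ∑ i, x i ⊗ₜ y i := by
    induction z using TensorProduct.induction_on with
    | zero => exact ⟨0, Fin.elim0, Fin.elim0, by simp⟩
    | tmul x y => exact ⟨1, fun _ => x, fun _ => y, by simp⟩
    | add z w hz hw =>
      obtain ⟨n, x, y, rfl⟩ := hz
      obtain ⟨m, x', y', rfl⟩ := hw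
      exact ⟨n + m, Fin.append x x', Fin.append y y', by simp [Fin.sum_univ_add]⟩
  obtain ⟨b, hb⟩ := exists_eq_star_mul_self (gram_nonneg X.toHilbertModule x)
  have hb' : ∀ i j, X.ip (x i) (x j) = ∑ k, star (b k i) * b k j := fun i j =>
    congrFun (congrFun hb i) j
  have key : X.tensorIP Y (∑ i, x i ⊗ₜ y i) (∑ i, x i ⊗ₜ y i)
      = ∑ k, Y.ip (∑ i, Y.left (b k i) (y i)) (∑ j, Y.left (b k j) (y j)) := by
    simp only [map_sum, LinearMap.sum_apply, tensorIP_tmul, hb', map_mul]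
    have e : ∀ i j : Fin n,
        Y.ip (y i) ((∑ k, Y.left (star (b k i)) * Y.left (b k j)) (y j))
          = ∑ k, Y.ip (Y.left (b k i) (y i)) (Y.left (b k j) (y j)) := by
      intro i j
      have : (∑ k, Y.left (star (b k i)) * Y.left (b k j)) (y j)
          = ∑ k, Y.left (star (b k i)) (Y.left (b k j) (y j)) := by simp
      rw [this, map_sum]
      refine Finset.sum_congr rfl fun k _ => ?_
      rw [← Y.left_adj, star_star]
    simp only [e]
    rw [Finset.sum_congr rfl fun i _ => Finset.sum_comm, Finset.sum_comm]
  rw [key]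
  exact Finset.sum_nonneg fun k _ => Y.ip_nonneg _

/-- The semi-inner product on the algebraic tensor product, with the right action on `Y`. -/
noncomputable def tensorSemi : SemiIP C (X.carrier ⊗[ℂ] Y.carrier) where
  ip := X.tensorIP Y
  ract c := LinearMap.lTensor X.carrier
    { toFun := fun y => op c • y
      map_add' := smul_add _
      map_smul' := fun z y => (smul_comm z (op c) y).symm }
  ip_ract z w c := by
    induction z using TensorProduct.induction_on with
    | zero => simp
    | add z z' hz hz' => rw [map_add, LinearMap.add_apply, LinearMap.add_apply, hz, hz', add_mul]
    | tmul x y =>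
      induction w using TensorProduct.induction_on with
      | zero => simp
      | add w w' hw hw' => rw [map_add, map_add, hw, hw', map_add, add_mul]
      | tmul x' y' =>
        rw [LinearMap.lTensor_tmul, tensorIP_tmul, tensorIP_tmul]
        change Y.ip y (Y.left (X.ip x x') (op c • y')) = _
        rw [← Y.left_adj, Y.ip_smul, Y.left_adj]
  star_ip z w := by
    induction z using TensorProduct.induction_on with
    | zero => simp
    | add z z' hz hz' =>
      rw [map_add, LinearMap.add_apply, star_add, hz, hz', map_add]
    | tmul x y =>
      induction w using TensorProduct.induction_on with
      | zero => simp
      | add w w' hw hw' => rw [map_add, star_add, hw, hw', map_add, LinearMap.add_apply]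
      | tmul x' y' =>
        rw [tensorIP_tmul, tensorIP_tmul, Y.star_ip, ← X.star_ip x x', ← Y.left_adj, star_star]
  nonneg := X.tensorIP_nonneg Y

/-- The action `π_X ⊗ 1` on the algebraic tensor product. -/
noncomputable def leftAct : A →ₙₐ[ℂ] Module.End ℂ (X.carrier ⊗[ℂ] Y.carrier) where
  toFun a := LinearMap.rTensor Y.carrier (X.left a).toLinearMap
  map_smul' z a := by ext; simp [TensorProduct.smul_tmul']
  map_zero' := by ext; simp
  map_add' a b := by ext; simp
  map_mul' a b := by ext; simp

theorem leftAct_adj (a : A) (z w : X.carrier ⊗[ℂ] Y.carrier) :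
    (X.tensorSemi Y).ip (X.leftAct Y (star a) z) w
      = (X.tensorSemi Y).ip z (X.leftAct Y a w) := by
  change X.tensorIP Y (LinearMap.rTensor Y.carrier (X.left (star a)).toLinearMap z) w
    = X.tensorIP Y z (LinearMap.rTensor Y.carrier (X.left a).toLinearMap w)
  induction z using TensorProduct.induction_on with
  | zero => simp
  | add z z' hz hz' => simp only [map_add, LinearMap.add_apply, hz, hz']
  | tmul x y =>
    induction w using TensorProduct.induction_on with
    | zero => simp
    | add w w' hw hw' => simp only [map_add, hw, hw']
    | tmul x' y' =>
      rw [LinearMap.rTensor_tmul, LinearMap.rTensor_tmul, tensorIP_tmul, tensorIP_tmul]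
      exact congrArg (fun b => Y.ip y (Y.left b y')) (X.left_adj a x x')

/-- The interior tensor product `X ⊗_B Y` of correspondences, with left action `π_X ⊗ 1`. -/
noncomputable def tensor : Corr A C := (X.tensorSemi Y).corr (X.leftAct Y) (X.leftAct_adj Y)

variable {D : Type*} [NonUnitalCStarAlgebra D] (τ : D →ₙₐ[ℂ] (Y.carrier →L[ℂ] Y.carrier))

/-- The action `1 ⊗ τ` on the algebraic tensor product. -/
noncomputable def rightAct : D →ₙₐ[ℂ] Module.End ℂ (X.carrier ⊗[ℂ] Y.carrier) where
  toFun d := LinearMap.lTensor X.carrier (τ d).toLinearMap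
  map_smul' z c := by ext; simp
  map_zero' := by ext; simp
  map_add' c d := by ext; simp
  map_mul' c d := by ext; simp

theorem rightAct_adj
    (hτ : ∀ (d : D) (x y : Y.carrier), Y.ip (τ (star d) x) y = Y.ip x (τ d y))
    (hc : ∀ (b : B) (d : D) (y : Y.carrier), Y.left b (τ d y) = τ d (Y.left b y))
    (d : D) (z w : X.carrier ⊗[ℂ] Y.carrier) :
    (X.tensorSemi Y).ip (X.rightAct Y τ (star d) z) w
      = (X.tensorSemi Y).ip z (X.rightAct Y τ d w) := by
  change X.tensorIP Y (LinearMap.lTensor X.carrier (τ (star d)).toLinearMap z) w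
    = X.tensorIP Y z (LinearMap.lTensor X.carrier (τ d).toLinearMap w)
  induction z using TensorProduct.induction_on with
  | zero => simp
  | add z z' hz hz' => simp only [map_add, LinearMap.add_apply, hz, hz']
  | tmul x y =>
    induction w using TensorProduct.induction_on with
    | zero => simp
    | add w w' hw hw' => simp only [map_add, hw, hw']
    | tmul x' y' =>
      rw [LinearMap.lTensor_tmul, LinearMap.lTensor_tmul, tensorIP_tmul, tensorIP_tmul]
      change Y.ip (τ (star d) y) _ = Y.ip y (Y.left _ (τ d y'))
      rw [hτ, hc]

variable (hτ : ∀ (d : D) (x y : Y.carrier), Y.ip (τ (star d) x) y = Y.ip x (τ d y))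
  (hc : ∀ (b : B) (d : D) (y : Y.carrier), Y.left b (τ d y) = τ d (Y.left b y))

/-- For a `*`-homomorphism `τ` from `D` to the adjointable operators on `Y` that commute with the
left action, the `*`-homomorphism `1 ⊗ τ` from `D` to the adjointable operators on `X ⊗_B Y`. -/
noncomputable def tensorRight : D →ₙₐ[ℂ] ((X.tensor Y).carrier →L[ℂ] (X.tensor Y).carrier) :=
  (X.tensorSemi Y).rep (X.rightAct Y τ) (X.rightAct_adj Y τ hτ hc)

theorem tensorRight_adj (d : D) (x y : (X.tensor Y).carrier) :
    (X.tensor Y).ip (X.tensorRight Y τ hτ hc (star d) x) y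
      = (X.tensor Y).ip x (X.tensorRight Y τ hτ hc d y) :=
  (X.tensorSemi Y).rep_adj (X.rightAct Y τ) (X.rightAct_adj Y τ hτ hc) d x y

theorem commute_tensorRight (a : A) (d : D) :
    Commute ((X.tensor Y).left a) (X.tensorRight Y τ hτ hc d) := by
  refine (X.tensorSemi Y).hat_op_ext fun z => ?_
  change (X.tensorSemi Y).rep _ (X.leftAct_adj Y) a
      ((X.tensorSemi Y).rep _ (X.rightAct_adj Y τ hτ hc) d ((X.tensorSemi Y).incl z))
    = (X.tensorSemi Y).rep _ (X.rightAct_adj Y τ hτ hc) d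
      ((X.tensorSemi Y).rep _ (X.leftAct_adj Y) a ((X.tensorSemi Y).incl z))
  rw [SemiIP.rep_incl, SemiIP.rep_incl, SemiIP.rep_incl, SemiIP.rep_incl]
  refine congrArg _ ?_
  change LinearMap.rTensor Y.carrier (X.left a).toLinearMap
      (LinearMap.lTensor X.carrier (τ d).toLinearMap z)
    = LinearMap.lTensor X.carrier (τ d).toLinearMap
      (LinearMap.rTensor Y.carrier (X.left a).toLinearMap z)
  rw [← LinearMap.comp_apply, ← LinearMap.comp_apply, LinearMap.rTensor_comp_lTensor,
    LinearMap.lTensor_comp_rTensor]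

end Tensor

end Corr

/-! ### Hilbert spaces -/

/-- A Hilbert module over `ℂ` is a Hilbert space. -/
noncomputable instance (X : HilbertModule.{0, w} ℂ) : InnerProductSpace ℂ X.carrier where
  inner x y := X.ip x y
  norm_sq_eq_re_inner x := by
    rw [X.norm_eq, Real.sq_sqrt (norm_nonneg _)]
    have h := X.ip_nonneg x
    exact (Complex.re_eq_norm.2 h).symm
  conj_inner_symm x y := X.star_ip y x
  add_left x y z := by simp
  smul_left x y c := by simp

section Reps

variable {A : Type u} [CStarAlgebra A] {H : Type w} [NormedAddCommGroup H] [InnerProductSpace ℂ H]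
  [CompleteSpace H]

/-- A `*`-representation on a Hilbert space, regarded as an `A`-`ℂ` correspondence. -/
noncomputable def Corr.ofRep (σ : A →⋆ₙₐ[ℂ] (H →L[ℂ] H)) : Corr.{u, 0, w} A ℂ :=
  letI : Module ℂᵐᵒᵖ H := Module.compHom H (RingEquiv.toOpposite ℂ).symm.toRingHom
  { carrier := H
    isScalarTower := ⟨fun z b x => mul_smul z b.unop x⟩
    smulCommClass := ⟨fun z b x => smul_comm z b.unop x⟩
    ip := innerₛₗ ℂ
    ip_smul := fun x y b => by
      change inner ℂ x (b • y) = inner ℂ x y * b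
      rw [inner_smul_right, mul_comm]
    star_ip := fun x y => inner_conj_symm y x
    ip_nonneg := fun x => by
      change 0 ≤ inner ℂ x x
      rw [inner_self_eq_norm_sq_to_K]
      exact Complex.zero_le_real.2 (sq_nonneg ‖x‖) |>.trans_eq (by simp)
    norm_eq := fun x => by
      change ‖x‖ = √‖inner ℂ x x‖
      rw [inner_self_eq_norm_sq_to_K, norm_pow, RCLike.norm_ofReal, abs_norm, Real.sqrt_sq (norm_nonneg x)]
    left := σ.toNonUnitalAlgHom
    left_adj := fun a x y => by
      change inner ℂ (σ (star a) x) y = inner ℂ x (σ a y)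
      rw [map_star, ContinuousLinearMap.star_eq_adjoint, ContinuousLinearMap.adjoint_inner_left] }

end Reps

/-! ### The maximal tensor product and its representations -/

/-- A pair of `*`-representations of `A` and `C` with commuting ranges on a Hilbert space: the
same thing as a `*`-representation of the algebraic tensor product of `A` and `C`, given
by `a ⊗ c ↦ σA a * σC c`. -/
structure CommPair (A C : Type u) [CStarAlgebra A] [NonUnitalCStarAlgebra C] where
  H : Type u
  [normedAddCommGroup : NormedAddCommGroup H]
  [innerProductSpace : InnerProductSpace ℂ H]
  [completeSpace : CompleteSpace H]
  σA : A →⋆ₙₐ[ℂ] (H →L[ℂ] H)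
  σC : C →⋆ₙₐ[ℂ] (H →L[ℂ] H)
  commute : ∀ a c, Commute (σA a) (σC c)

attribute [instance] CommPair.normedAddCommGroup CommPair.innerProductSpace CommPair.completeSpace

section Max

variable (A C : Type u) [CStarAlgebra A] [NonUnitalCStarAlgebra C]

/-- The product of all the algebras `B(H)`, over all the commuting pairs of representations. -/
abbrev UnivProd : Type (u + 1) := lp (fun p : CommPair.{u} A C => p.H →L[ℂ] p.H) ∞

variable {A C}

/-- The elementary tensor `a ⊗ c`. -/
noncomputable def pureTensor (a : A) (c : C) : UnivProd A C :=
  ⟨fun p => p.σA a * p.σC c, memℓp_infty ⟨‖a‖ * ‖c‖, by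
    rintro _ ⟨p, rfl⟩
    exact (norm_mul_le _ _).trans (mul_le_mul (NonUnitalStarAlgHom.norm_apply_le _ _)
      (NonUnitalStarAlgHom.norm_apply_le _ _) (norm_nonneg _) (norm_nonneg _))⟩⟩

variable (A C)

/-- The maximal tensor product: the completion of the algebraic tensor product for the norm
`sup ‖∑ σA (a i) * σC (c i)‖` over all commuting pairs of representations, realized as the closed
`*`-subalgebra that the elementary tensors generate in the product of all the `B(H)`. -/
noncomputable def MaxTensor : NonUnitalStarSubalgebra ℂ (UnivProd A C) :=
  (NonUnitalStarAlgebra.adjoin ℂ (Set.range fun q : A × C => pureTensor q.1 q.2)).topologicalClosure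

variable {A C}

/-- The representation of the maximal tensor product with `a ⊗ c ↦ σA a * σC c`. -/
noncomputable def CommPair.rep (p : CommPair A C) : MaxTensor A C →⋆ₙₐ[ℂ] (p.H →L[ℂ] p.H) where
  toFun z := z.1 p
  map_smul' _ _ := rfl
  map_zero' := rfl
  map_add' _ _ := rfl
  map_mul' _ _ := rfl
  map_star' _ := rfl

/-- The representation of the maximal tensor product is nondegenerate. -/
def CommPair.Nondegenerate (p : CommPair A C) : Prop :=
  Dense (Submodule.span ℂ {h : p.H | ∃ (z : MaxTensor A C) (k : p.H), h = p.rep z k} : Set p.H)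

end Max

/-- Weak containment of `*`-representations: `π ≺ ρ` if `ker ρ ⊆ ker π`. -/
def WeaklyContained {D : Type*} [NonUnitalNonAssocSemiring D] [DistribMulAction ℂ D] [Star D]
    {H K : Type*}
    [NormedAddCommGroup H] [InnerProductSpace ℂ H] [CompleteSpace H]
    [NormedAddCommGroup K] [InnerProductSpace ℂ K] [CompleteSpace K]
    (π : D →⋆ₙₐ[ℂ] (H →L[ℂ] H)) (ρ : D →⋆ₙₐ[ℂ] (K →L[ℂ] K)) : Prop :=
  ∀ z, ρ z = 0 → π z = 0

/-! ### The universal factorization property -/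

section UFP

variable {A : Type u} [CStarAlgebra A] [PartialOrder A] [StarOrderedRing A]

theorem CommPair.adj_right {C : Type u} [NonUnitalCStarAlgebra C] (σ : CommPair A C) (c : C)
    (x y : (Corr.ofRep σ.σA).carrier) :
    (Corr.ofRep σ.σA).ip (σ.σC (star c) x) y = (Corr.ofRep σ.σA).ip x (σ.σC c y) := by
  have h : ∀ x y : σ.H, inner ℂ (σ.σC (star c) x) y = inner ℂ x (σ.σC c y) := fun x y => by
    rw [StarHomClass.map_star, ContinuousLinearMap.star_eq_adjoint,
      ContinuousLinearMap.adjoint_inner_left]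
  exact h x y

theorem CommPair.comm_right {C : Type u} [NonUnitalCStarAlgebra C] (σ : CommPair A C) (a : A)
    (c : C) (y : (Corr.ofRep σ.σA).carrier) :
    (Corr.ofRep σ.σA).left a (σ.σC c y) = σ.σC c ((Corr.ofRep σ.σA).left a y) :=
  DFunLike.congr_fun (σ.commute a c).eq y

/-- The commuting pair `(π_X ⊗ 1, 1 ⊗ σC)` on the Hilbert space `X ⊗_{σA} H`; its representation of
the maximal tensor product sends `a ⊗ c` to `π_X(a) ⊗ σC(c)`. -/
noncomputable def inducedPair (X : Corr.{u, u, u} A A) {C : Type u} [NonUnitalCStarAlgebra C]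
    (σ : CommPair A C) : CommPair A C where
  H := (X.tensor (Corr.ofRep σ.σA)).carrier
  σA :=
    { (X.tensor (Corr.ofRep σ.σA)).left with
      map_star' := fun a => (ContinuousLinearMap.eq_adjoint_iff _ _).2
        ((X.tensor (Corr.ofRep σ.σA)).left_adj a) }
  σC :=
    { X.tensorRight (Corr.ofRep σ.σA) σ.σC.toNonUnitalAlgHom σ.adj_right σ.comm_right with
      map_star' := fun c => (ContinuousLinearMap.eq_adjoint_iff _ _).2
        (X.tensorRight_adj (Corr.ofRep σ.σA) σ.σC.toNonUnitalAlgHom σ.adj_right σ.comm_right c) }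
  commute a c := X.commute_tensorRight (Corr.ofRep σ.σA) σ.σC.toNonUnitalAlgHom σ.adj_right
    σ.comm_right a c

/-- The universal factorization property: for every C⋆-algebra `C`, each nondegenerate
representation of `A ⊗_max C` is weakly contained in the induced one on `X ⊗_{σA} H`. -/
def UFP (X : Corr.{u, u, u} A A) : Prop :=
  ∀ (C : Type u) [NonUnitalCStarAlgebra C] (σ : CommPair A C), σ.Nondegenerate →
    WeaklyContained σ.rep (inducedPair X σ).rep

end UFP

/-! ### Conditional expectations and relative nuclearity -/

section Nuclear

variable {A B : Type u} [CStarAlgebra A] [PartialOrder A] [StarOrderedRing A]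
  [CStarAlgebra B] [PartialOrder B] [StarOrderedRing B]

/-- A conditional expectation for the unital inclusion `ι : B → A`: a positive linear
`B`-bimodule map onto `B` that restricts to the identity of `B`. (Complete positivity and
contractivity are automatic; so is the injectivity of `ι`, by `map_ι`.) -/
structure CondExp (ι : B →⋆ₐ[ℂ] A) extends A →ₗ[ℂ] B where
  map_nonneg : ∀ a : A, 0 ≤ a → 0 ≤ toFun a
  map_ι : ∀ b : B, toFun (ι b) = b
  map_bimod : ∀ (b b' : B) (a : A), toFun (ι b * a * ι b') = b * toFun a * b'

variable {ι : B →⋆ₐ[ℂ] A} (E : CondExp ι)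

theorem CondExp.map_star (a : A) : E.toLinearMap (star a) = star (E.toLinearMap a) := by
  let F : A →ₚ[ℂ] B := PositiveLinearMap.mk₀ E.toLinearMap E.map_nonneg
  exact StarHomClass.map_star F a

/-- The semi-inner product `⟨a, b⟩ = E(a⋆ b)` on `A`. -/
noncomputable def CondExp.semi : SemiIP B A where
  ip := LinearMap.mk₂'ₛₗ (starRingEnd ℂ) (RingHom.id ℂ) (fun a b => E.toLinearMap (star a * b))
    (fun x y z => by simp [add_mul]) (fun c x y => by simp) (fun x y z => by simp [mul_add])
    (fun c x y => by simp)
  ract b a := a * ι b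
  ip_ract x y b := by
    change E.toLinearMap (star x * (y * ι b)) = E.toLinearMap (star x * y) * b
    have h := E.map_bimod 1 b (star x * y)
    rwa [map_one, one_mul, one_mul, mul_assoc] at h
  star_ip x y := by
    change star (E.toLinearMap (star x * y)) = E.toLinearMap (star y * x)
    rw [← E.map_star, star_mul, star_star]
  nonneg x := E.map_nonneg _ (star_mul_self_nonneg x)

/-- The GNS correspondence `L²(A, E)`, with left action by left multiplication. -/
noncomputable def CondExp.L2 : Corr.{u, u, u} A B :=
  E.semi.corr (NonUnitalAlgHom.lmul ℂ A) (fun a x y => by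
    change E.toLinearMap (star (star a * x) * y) = E.toLinearMap (star x * (a * y))
    rw [star_mul, star_star, mul_assoc])

/-- The C⋆-algebra `A` as a `B`-`A` correspondence: `⟨x, y⟩ = x⋆ y`, with `B` acting on the left
through the inclusion `ι`. -/
noncomputable def algCorr (ι : B →⋆ₐ[ℂ] A) : Corr.{u, u, u} B A where
  carrier := A
  ip := LinearMap.mk₂'ₛₗ (starRingEnd ℂ) (RingHom.id ℂ) (fun a b => star a * b)
    (fun x y z => by simp [add_mul]) (fun c x y => by simp) (fun x y z => by simp [mul_add])
    (fun c x y => by simp)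
  ip_smul x y a := (mul_assoc (star x) y a).symm
  star_ip x y := by
    change star (star x * y) = star y * x
    rw [star_mul, star_star]
  ip_nonneg x := star_mul_self_nonneg x
  norm_eq x := by
    change ‖x‖ = √‖star x * x‖
    rw [CStarRing.norm_star_mul_self, Real.sqrt_mul_self (norm_nonneg x)]
  left :=
    { toFun := fun b => ContinuousLinearMap.mul ℂ A (ι b)
      map_smul' := fun z b => by ext; simp
      map_zero' := by ext; simp
      map_add' := fun b c => by ext; simp
      map_mul' := fun b c => by ext; simp [mul_assoc] }
  left_adj b x y := by
    change star (ι (star b) * x) * y = star x * (ι b * y)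
    rw [star_mul, StarHomClass.map_star, star_star, mul_assoc]

/-- Nuclearity of the triple `(A, B, E)`. -/
def CondExp.IsNuclear : Prop := UFP (E.L2.tensor (algCorr ι))

end Nuclear

end RelNuc

/-! The coefficients `a ↦ ⟨ξ, a ξ⟩` of a correspondence `X` over `A` generate a convex cone of
completely positive maps, and `X` has the universal factorization property if and only if the
identity of `A` lies in the point-norm closure of this cone.

If it does, then `⟨h, σ(z) h⟩` is a limit of sums of terms `⟨ξ ⊗ h, φ_X(z) (ξ ⊗ h)⟩`, hence
vanishes with `φ_X(z)`. If it does not, Hahn–Banach gives a separating functional on a finite power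
of `A`; enlarging the cone by dissipative elements forces its components `fᵢ` to be positive. All
`fᵢ` are dominated by one positive functional, and their Radon–Nikodym derivatives lie in the
commutant of its GNS representation. The factorization property for the resulting commuting pair
contradicts the separation.

In `L²(A, E) ⊗_B A` the finite sums `∑ xᵢ ⊗ yᵢ` with `xᵢ` in `A` are dense, and their coefficients
are the maps `ψ ∘ φ` of the theorem. -/

namespace RelNuc

/-! ### Completely positive maps attached to correspondences -/

section CompletelyPositive

theorem cstarMatrix_sum_apply {R I J K : Type*} [AddCommMonoid R] (s : Finset K)
    (M : K → CStarMatrix I J R) (i : I) (j : J) : (∑ k ∈ s, M k) i j = ∑ k ∈ s, M k i j :=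
  Matrix.sum_apply i j s M

theorem cstarMatrix_ofMatrix_apply {R I J : Type*} (f : I → J → R) (i : I) (j : J) :
    CStarMatrix.ofMatrix f i j = f i j := rfl

theorem HilbertModule.ip_op_smul_left {B : Type*} [CStarAlgebra B] [PartialOrder B]
    (X : HilbertModule B) (b : B) (x y : X.carrier) : X.ip (op b • x) y = star b * X.ip x y := by
  rw [← X.star_ip, X.ip_smul, star_mul, X.star_ip]

theorem Corr.ip_star_mul_left {A B : Type*} [CStarAlgebra A] [CStarAlgebra B] [PartialOrder B]
    (X : Corr A B) (a b : A) (x y : X.carrier) :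
    X.ip x (X.left (star a * b) y) = X.ip (X.left a x) (X.left b y) := by
  rw [map_mul, mul_apply_eq_comp, ← X.left_adj, star_star]

variable {A B C : Type*} [CStarAlgebra A] [PartialOrder A] [StarOrderedRing A]
  [CStarAlgebra B] [PartialOrder B] [StarOrderedRing B]
  [CStarAlgebra C] [PartialOrder C] [StarOrderedRing C]

theorem HilbertModule.gram_block_nonneg (X : HilbertModule B) {k n : ℕ}
    (ξ : Fin k → Fin n → X.carrier) :
    0 ≤ (CStarMatrix.ofMatrix fun p q => CStarMatrix.ofMatrix fun i j => X.ip (ξ p i) (ξ q j) :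
      CStarMatrix (Fin k) (Fin k) (CStarMatrix (Fin n) (Fin n) B)) := by
  refine matrix_nonneg _ ?_ fun c => ?_
  · ext p q i j
    exact X.star_ip (ξ q j) (ξ p i)
  · refine (Corr.gram_nonneg X fun i => ∑ p, ∑ s, op (c p s i) • ξ p s).trans_eq ?_
    ext i j
    simp only [cstarMatrix_sum_apply, cstarMatrix_ofMatrix_apply, CStarMatrix.mul_apply,
      CStarMatrix.star_apply, map_sum, LinearMap.sum_apply, X.ip_smul, X.ip_op_smul_left,
      Finset.sum_mul]
    exact Finset.sum_comm_cycle

/-- The completely positive map `a ↦ [⟨xᵢ, a xⱼ⟩]` given by vectors of a correspondence. -/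
noncomputable def Corr.compress (X : Corr A B) {n : ℕ} (x : Fin n → X.carrier) :
    A →CP CStarMatrix (Fin n) (Fin n) B where
  toFun a := CStarMatrix.ofMatrix fun i j => X.ip (x i) (X.left a (x j))
  map_add' a b := CStarMatrix.ext fun i j => by
    change X.ip (x i) (X.left (a + b) (x j)) = _ + _
    rw [map_add, add_apply, map_add]
    rfl
  map_smul' z a := CStarMatrix.ext fun i j => by
    change X.ip (x i) (X.left (z • a) (x j)) = z • _
    rw [map_smul, smul_apply, map_smul]
    rfl
  map_cstarMatrix_nonneg' k M hM := by
    obtain ⟨N, rfl⟩ := exists_eq_star_mul_self hM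
    change 0 ≤ CStarMatrix.ofMatrix fun p q => CStarMatrix.ofMatrix fun i j =>
      X.ip (x i) (X.left ((star N * N) p q) (x j))
    have hgram : 0 ≤ ∑ r, (CStarMatrix.ofMatrix fun p q => CStarMatrix.ofMatrix fun i j =>
        X.ip (X.left (N r p) (x i)) (X.left (N r q) (x j)) :
        CStarMatrix (Fin k) (Fin k) (CStarMatrix (Fin n) (Fin n) B)) :=
      Finset.sum_nonneg fun r _ => X.gram_block_nonneg fun p i => X.left (N r p) (x i)
    refine hgram.trans_eq ?_
    ext p q i j
    simp only [cstarMatrix_sum_apply, cstarMatrix_ofMatrix_apply, CStarMatrix.mul_apply,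
      CStarMatrix.star_apply, map_sum, sum_apply, X.ip_star_mul_left]

/-- The completely positive map `[bᵢⱼ] ↦ ∑ ⟨yᵢ, bᵢⱼ yⱼ⟩` given by vectors of a correspondence. -/
noncomputable def Corr.rowSum (Y : Corr B C) {n : ℕ} (y : Fin n → Y.carrier) :
    CStarMatrix (Fin n) (Fin n) B →CP C where
  toFun b := ∑ i, ∑ j, Y.ip (y i) (Y.left (b i j) (y j))
  map_add' a b := by simp [Finset.sum_add_distrib]
  map_smul' z a := by simp [Finset.smul_sum]
  map_cstarMatrix_nonneg' k M hM := by
    obtain ⟨N, rfl⟩ := exists_eq_star_mul_self hM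
    change 0 ≤ CStarMatrix.ofMatrix fun p q =>
      ∑ i, ∑ j, Y.ip (y i) (Y.left ((star N * N) p q i j) (y j))
    have hgram : 0 ≤ ∑ r, ∑ s, (CStarMatrix.ofMatrix fun p q =>
        Y.ip (∑ i, Y.left (N r p s i) (y i)) (∑ j, Y.left (N r q s j) (y j)) :
        CStarMatrix (Fin k) (Fin k) C) :=
      Finset.sum_nonneg fun r _ => Finset.sum_nonneg fun s _ =>
        Corr.gram_nonneg Y.toHilbertModule fun p => ∑ i, Y.left (N r p s i) (y i)
    refine hgram.trans_eq ?_
    ext p q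
    simp only [cstarMatrix_sum_apply, cstarMatrix_ofMatrix_apply, CStarMatrix.mul_apply,
      CStarMatrix.star_apply, map_sum, sum_apply, LinearMap.sum_apply, Y.ip_star_mul_left]
    rw [Finset.sum_comm_cycle]
    refine Eq.trans ?_ Finset.sum_comm
    exact Finset.sum_congr rfl fun j _ => Finset.sum_comm_cycle

end CompletelyPositive

/-! ### Elementary tensors -/

section Tmul

variable {A B C : Type*} [CStarAlgebra A] [CStarAlgebra B] [PartialOrder B] [StarOrderedRing B]

/-- The inner product of a Hilbert module, as a semi-inner product. -/
noncomputable def HilbertModule.toSemiIP (X : HilbertModule B) : SemiIP B X.carrier where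
  ip := X.ip
  ract b x := op b • x
  ip_ract := X.ip_smul
  star_ip := X.star_ip
  nonneg := X.ip_nonneg

theorem HilbertModule.norm_ip_le (X : HilbertModule B) (x y : X.carrier) :
    ‖X.ip x y‖ ≤ ‖x‖ * ‖y‖ := by
  rw [X.norm_eq x, X.norm_eq y]
  exact X.toSemiIP.norm_ip_le x y

theorem Corr.norm_left_le (X : Corr A B) (a : A) (x : X.carrier) :
    ‖X.left a x‖ ≤ ‖a‖ * ‖x‖ := by
  let ρ : A →ₙₐ[ℂ] Module.End ℂ X.carrier :=
    { toFun a := (X.left a).toLinearMap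
      map_smul' z a := by rw [map_smul]; rfl
      map_zero' := by rw [map_zero]; rfl
      map_add' a b := by rw [map_add]; rfl
      map_mul' a b := by rw [map_mul]; rfl }
  have hle := X.toSemiIP.norm_rep_le ρ X.left_adj a x
  rw [LinearMap.comp_apply, SemiIP.norm_incl, SemiIP.norm_incl] at hle
  rw [X.norm_eq, X.norm_eq x]
  exact hle

variable [CStarAlgebra C] [PartialOrder C] [StarOrderedRing C] (X : Corr A B) (Y : Corr B C)

/-- The algebraic bilinear map `(x, y) ↦ x ⊗ y` into `X ⊗_B Y`; `Corr.tmul` is its continuous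
version. -/
noncomputable def Corr.tmulBilin : X.carrier →ₗ[ℂ] Y.carrier →ₗ[ℂ] (X.tensor Y).carrier :=
  (TensorProduct.mk ℂ X.carrier Y.carrier).compr₂ (X.tensorSemi Y).incl

theorem Corr.ip_tmulBilin (x x' : X.carrier) (y y' : Y.carrier) :
    (X.tensor Y).ip (X.tmulBilin Y x y) (X.tmulBilin Y x' y') = Y.ip y (Y.left (X.ip x x') y') :=
  (X.tensorSemi Y).ipHat_incl _ _

theorem Corr.norm_tmulBilin_le (x : X.carrier) (y : Y.carrier) :
    ‖X.tmulBilin Y x y‖ ≤ 1 * ‖x‖ * ‖y‖ := by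
  rw [(X.tensor Y).norm_eq, X.ip_tmulBilin, one_mul, Real.sqrt_le_left (by positivity)]
  calc ‖Y.ip y (Y.left (X.ip x x) y)‖ ≤ ‖y‖ * (‖X.ip x x‖ * ‖y‖) :=
        (Y.norm_ip_le _ _).trans (by gcongr; exact Y.norm_left_le _ _)
    _ = (‖x‖ * ‖y‖) ^ 2 := by
        rw [X.norm_eq, mul_pow, Real.sq_sqrt (norm_nonneg _)]
        ring

/-- The elementary tensor `x ⊗ y` in the interior tensor product `X ⊗_B Y`. -/
noncomputable def Corr.tmul : X.carrier →L[ℂ] Y.carrier →L[ℂ] (X.tensor Y).carrier :=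
  (X.tmulBilin Y).mkContinuous₂ 1 (X.norm_tmulBilin_le Y)

theorem Corr.ip_tmul (x x' : X.carrier) (y y' : Y.carrier) :
    (X.tensor Y).ip (X.tmul Y x y) (X.tmul Y x' y') = Y.ip y (Y.left (X.ip x x') y') :=
  X.ip_tmulBilin Y x x' y y'

theorem Corr.left_tmul (a : A) (x : X.carrier) (y : Y.carrier) :
    (X.tensor Y).left a (X.tmul Y x y) = X.tmul Y (X.left a x) y :=
  (X.tensorSemi Y).rep_incl _ (X.leftAct_adj Y) _ _

theorem Corr.tmul_op_smul (x : X.carrier) (b : B) (y : Y.carrier) :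
    X.tmul Y (op b • x) y = X.tmul Y x (Y.left b y) := by
  have key : (X.tensorSemi Y).incl ((op b • x) ⊗ₜ[ℂ] y - x ⊗ₜ[ℂ] Y.left b y) = 0 := by
    refine (X.tensorSemi Y).incl_eq_zero fun w => ?_
    induction w using TensorProduct.induction_on with
    | zero => simp
    | add z w hz hw => rw [map_add, LinearMap.add_apply, hz, hw, add_zero]
    | tmul x' y' =>
      refine (map_sub (X.tensorIP Y (x' ⊗ₜ y')) _ _).trans ?_
      rw [Corr.tensorIP_tmul, Corr.tensorIP_tmul, X.ip_smul, map_mul]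
      exact sub_self _
  rw [map_sub] at key
  exact sub_eq_zero.1 key

theorem Corr.mem_of_tmul_mem {S : Submodule ℂ (X.tensor Y).carrier}
    (hS : IsClosed (S : Set (X.tensor Y).carrier)) (tmul_mem : ∀ x y, X.tmul Y x y ∈ S)
    (v : (X.tensor Y).carrier) : v ∈ S := by
  refine (X.tensorSemi Y).denseRange_incl.induction_on (p := fun v => v ∈ S) v hS fun z => ?_
  induction z using TensorProduct.induction_on with
  | zero => exact (map_zero (X.tensorSemi Y).incl).symm ▸ S.zero_mem
  | tmul x y => exact tmul_mem x y
  | add z w hz hw => exact (map_add (X.tensorSemi Y).incl z w).symm ▸ S.add_mem hz hw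

end Tmul

section Induced

variable {A : Type u} [CStarAlgebra A] [PartialOrder A] [StarOrderedRing A]
  (X : Corr.{u, u, u} A A) {C : Type u} [NonUnitalCStarAlgebra C] (σ : CommPair A C)

/-- The elementary tensor `x ⊗ h` in `X ⊗_{σA} H`: this is `Corr.tmul`, with `h` and the result
regarded as vectors of Hilbert spaces. -/
noncomputable def inducedTmul : X.carrier →L[ℂ] σ.H →L[ℂ] (inducedPair X σ).H :=
  X.tmul (Corr.ofRep σ.σA)

theorem inner_inducedTmul (x x' : X.carrier) (h h' : σ.H) :
    inner ℂ (inducedTmul X σ x h) (inducedTmul X σ x' h') = inner ℂ h (σ.σA (X.ip x x') h') :=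
  X.ip_tmul (Corr.ofRep σ.σA) x x' h h'

theorem inducedPair_σA_tmul (a : A) (x : X.carrier) (h : σ.H) :
    (inducedPair X σ).σA a (inducedTmul X σ x h) = inducedTmul X σ (X.left a x) h :=
  X.left_tmul (Corr.ofRep σ.σA) a x h

theorem inducedPair_σC_tmul (c : C) (x : X.carrier) (h : σ.H) :
    (inducedPair X σ).σC c (inducedTmul X σ x h) = inducedTmul X σ x (σ.σC c h) :=
  (X.tensorSemi (Corr.ofRep σ.σA)).rep_incl
    (X.rightAct (Corr.ofRep σ.σA) σ.σC.toNonUnitalAlgHom)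
    (X.rightAct_adj (Corr.ofRep σ.σA) σ.σC.toNonUnitalAlgHom σ.adj_right σ.comm_right) c
    (x ⊗ₜ[ℂ] (show (Corr.ofRep σ.σA).carrier from h))

theorem inducedTmul_op_smul (x : X.carrier) (a : A) (h : σ.H) :
    inducedTmul X σ (op a • x) h = inducedTmul X σ x (σ.σA a h) :=
  X.tmul_op_smul (Corr.ofRep σ.σA) x a h

theorem denseRange_inducedTmul {Ω : σ.H} (hΩ : DenseRange fun a => σ.σA a Ω) :
    DenseRange fun x => inducedTmul X σ x Ω := by
  let S := (((inducedTmul X σ).flip Ω).toLinearMap.range).topologicalClosure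
  have hS : IsClosed (S : Set (inducedPair X σ).H) := Submodule.isClosed_topologicalClosure _
  refine X.mem_of_tmul_mem (Corr.ofRep σ.σA) (S := S) hS fun x h => ?_
  refine hΩ.induction_on (p := fun h => inducedTmul X σ x h ∈ S) h
    (hS.preimage (inducedTmul X σ x).continuous) fun a => ?_
  rw [← inducedTmul_op_smul]
  exact Submodule.le_topologicalClosure _ ⟨op a • x, rfl⟩

end Induced

theorem adjoin_eq_span_of_mul_mem {R : Type*} [NonUnitalRing R] [StarRing R] [Module ℂ R]
    [IsScalarTower ℂ R R] [SMulCommClass ℂ R R] [StarModule ℂ R] {s : Set R}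
    (hmul : ∀ x ∈ s, ∀ y ∈ s, x * y ∈ s) (hstar : ∀ x ∈ s, star x ∈ s) :
    (NonUnitalStarAlgebra.adjoin ℂ s).toSubmodule = Submodule.span ℂ s := by
  let S : Subsemigroup R := ⟨s, fun {x y} hx hy => hmul x hx y hy⟩
  have hs : s ∪ star s = S :=
    Set.union_eq_self_of_subset_right fun x hx => star_star x ▸ hstar _ hx
  rw [NonUnitalStarAlgebra.adjoin_eq_span, hs, Subsemigroup.closure_eq]
  rfl

section MaxTensor

variable {A C : Type u} [CStarAlgebra A] [NonUnitalCStarAlgebra C]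

-- Instance search on these large types is slow without the shortcuts.
noncomputable instance : AddCommMonoid (UnivProd A C) := inferInstance

noncomputable instance : SMul ℂ (UnivProd A C) := Module.toDistribMulAction.toSMul

instance : IsClosed (MaxTensor A C : Set (UnivProd A C)) :=
  NonUnitalStarSubalgebra.isClosed_topologicalClosure _

noncomputable instance : NonUnitalCStarAlgebra (MaxTensor A C) := inferInstance

noncomputable instance : AddCommMonoid (MaxTensor A C) := inferInstance

theorem pureTensor_smul_left (z : ℂ) (a : A) (c : C) :
    pureTensor (z • a) c = z • pureTensor a c := by
  ext p : 2
  exact congrArg (· * p.σC c) (map_smul p.σA z a) |>.trans (smul_mul_assoc _ _ _)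

theorem pureTensor_mul (a a' : A) (c c' : C) :
    pureTensor a c * pureTensor a' c' = pureTensor (a * a') (c * c') := by
  ext p : 2
  change p.σA a * p.σC c * (p.σA a' * p.σC c') = p.σA (a * a') * p.σC (c * c')
  rw [map_mul, map_mul, (p.commute a' c).symm.mul_mul_mul_comm]

theorem star_pureTensor (a : A) (c : C) :
    star (pureTensor a c) = pureTensor (star a) (star c) := by
  ext p : 2
  change star (p.σA a * p.σC c) = p.σA (star a) * p.σC (star c)
  rw [star_mul, ← map_star, ← map_star, (p.commute _ _).eq]

theorem exists_sum_of_mem_adjoin {z : UnivProd A C}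
    (hz : z ∈ NonUnitalStarAlgebra.adjoin ℂ (Set.range fun q : A × C => pureTensor q.1 q.2)) :
    ∃ (n : ℕ) (q : Fin n → A × C), z = ∑ i, pureTensor (q i).1 (q i).2 := by
  change z ∈ (NonUnitalStarAlgebra.adjoin ℂ _).toSubmodule at hz
  rw [adjoin_eq_span_of_mul_mem, Submodule.mem_span_set'] at hz
  · obtain ⟨n, f, g, rfl⟩ := hz
    choose q hq using fun i => (g i).2
    refine ⟨n, fun i => (f i • (q i).1, (q i).2), Finset.sum_congr rfl fun i _ => ?_⟩
    exact (congrArg _ (hq i).symm).trans (pureTensor_smul_left _ _ _).symm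
  · rintro _ ⟨q, rfl⟩ _ ⟨q', rfl⟩
    exact ⟨q * q', (pureTensor_mul _ _ _ _).symm⟩
  · rintro _ ⟨q, rfl⟩
    exact ⟨star q, (star_pureTensor _ _).symm⟩

/-- The elementary tensor `a ⊗ c` in the maximal tensor product. -/
noncomputable def tmul (a : A) (c : C) : MaxTensor A C :=
  ⟨pureTensor a c, NonUnitalStarSubalgebra.le_topologicalClosure _
    (NonUnitalStarAlgebra.subset_adjoin ℂ _ ⟨(a, c), rfl⟩)⟩

theorem CommPair.rep_tmul (p : CommPair A C) (a : A) (c : C) :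
    p.rep (tmul a c) = p.σA a * p.σC c := rfl

theorem denseRange_sum_tmul :
    DenseRange fun q : Σ n : ℕ, Fin n → A × C => ∑ i, tmul (q.2 i).1 (q.2 i).2 := by
  intro z
  rw [Topology.IsInducing.subtypeVal.closure_eq_preimage_closure_image]
  refine closure_mono (fun x hx => ?_) z.2
  obtain ⟨n, q, rfl⟩ := exists_sum_of_mem_adjoin hx
  exact ⟨_, ⟨⟨n, q⟩, rfl⟩, AddSubmonoidClass.coe_finsetSum _ _⟩

end MaxTensor

/-! ### Coefficients of a correspondence and the factorization property -/

section Coefficients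

variable {A : Type u} [CStarAlgebra A] [PartialOrder A] (X : Corr.{u, u, u} A A)

/-- The diagonal coefficient `a ↦ ⟨ξ, a ξ⟩` of a correspondence. -/
noncomputable def Corr.coeff (ξ : X.carrier) (a : A) : A := X.ip ξ (X.left a ξ)

/-- The convex cone spanned by the diagonal coefficients. It consists of completely positive maps,
but they are kept as bare functions so that closures are taken for pointwise norm convergence. -/
noncomputable def Corr.coeffCone : PointedCone ℝ (A → A) :=
  PointedCone.hull ℝ (Set.range X.coeff)

theorem Corr.coeff_smul (z : ℂ) (ξ : X.carrier) :
    X.coeff (z • ξ) = ‖z‖ ^ 2 • X.coeff ξ := by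
  ext a
  simp only [Corr.coeff, map_smul, map_smulₛₗ, LinearMap.smul_apply, smul_smul, Complex.mul_conj',
    Pi.smul_apply, ← Complex.ofReal_pow, Complex.coe_smul]

theorem Corr.coeff_one (ξ : X.carrier) : X.coeff ξ 1 = X.ip (X.left 1 ξ) (X.left 1 ξ) := by
  rw [← X.ip_star_mul_left, star_one, one_mul, Corr.coeff]

theorem Corr.coeff_eq_ip_left_one (ξ : X.carrier) (a : A) :
    X.coeff ξ a = X.ip (X.left 1 ξ) (X.left a (X.left 1 ξ)) := by
  rw [← mul_apply_eq_comp (X.left a), ← map_mul, mul_one, ← X.ip_star_mul_left, star_one, one_mul,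
    Corr.coeff]

variable {X}

theorem Corr.map_smul_of_mem_coeffCone {θ : A → A} (hθ : θ ∈ X.coeffCone) (z : ℂ) (a : A) :
    θ (z • a) = z • θ a := by
  induction hθ using Submodule.span_induction with
  | mem θ hθ =>
    obtain ⟨ξ, rfl⟩ := hθ
    simp [Corr.coeff]
  | zero => simp
  | add θ θ' _ _ hθ hθ' => simp [hθ, hθ']
  | smul t θ _ hθ =>
    change (t : ℝ) • θ (z • a) = z • (t : ℝ) • θ a
    rw [hθ, smul_comm]

variable [StarOrderedRing A] {C : Type u} [NonUnitalCStarAlgebra C] (σ : CommPair A C)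

theorem norm_inner_sum_coeff_le (ξ : X.carrier) {n : ℕ} (q : Fin n → A × C) (h : σ.H) :
    ‖inner ℂ h (∑ i, σ.σA (X.coeff ξ (q i).1) (σ.σC (q i).2 h))‖
      ≤ ‖(inducedPair X σ).rep (∑ i, tmul (q i).1 (q i).2)‖
        * (inner ℂ h (σ.σA (X.coeff ξ 1) h)).re := by
  let v := inducedTmul X σ (X.left 1 ξ) h
  have hv : (inner ℂ h (σ.σA (X.coeff ξ 1) h)).re = ‖v‖ ^ 2 := by
    rw [X.coeff_one, ← inner_inducedTmul]
    exact inner_self_eq_norm_sq (𝕜 := ℂ) v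
  have hT : inner ℂ h (∑ i, σ.σA (X.coeff ξ (q i).1) (σ.σC (q i).2 h))
      = inner ℂ v ((inducedPair X σ).rep (∑ i, tmul (q i).1 (q i).2) v) := by
    simp only [map_sum, sum_apply, inner_sum, CommPair.rep_tmul, mul_apply_eq_comp]
    refine Finset.sum_congr rfl fun i _ => ?_
    rw [inducedPair_σC_tmul, inducedPair_σA_tmul, inner_inducedTmul, X.coeff_eq_ip_left_one]
  rw [hv, hT]
  calc _ ≤ ‖v‖ * (‖(inducedPair X σ).rep (∑ i, tmul (q i).1 (q i).2)‖ * ‖v‖) :=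
        (norm_inner_le_norm _ _).trans (by gcongr; exact ContinuousLinearMap.le_opNorm _ _)
    _ = _ := by ring

theorem norm_inner_sum_le_of_mem_coeffCone {θ : A → A} (hθ : θ ∈ X.coeffCone) {n : ℕ}
    (q : Fin n → A × C) (h : σ.H) :
    ‖inner ℂ h (∑ i, σ.σA (θ (q i).1) (σ.σC (q i).2 h))‖
      ≤ ‖(inducedPair X σ).rep (∑ i, tmul (q i).1 (q i).2)‖
        * (inner ℂ h (σ.σA (θ 1) h)).re := by
  induction hθ using Submodule.span_induction with
  | mem θ hθ =>
    obtain ⟨ξ, rfl⟩ := hθ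
    exact norm_inner_sum_coeff_le σ ξ q h
  | zero => simp
  | add θ θ' _ _ hθ hθ' =>
    simp only [Pi.add_apply, map_add, add_apply, Finset.sum_add_distrib, inner_add_right,
      Complex.add_re, mul_add]
    exact (norm_add_le _ _).trans (add_le_add hθ hθ')
  | smul t θ _ hθ =>
    have hsmul (a : A) : (t • θ) a = ((t : ℝ) : ℂ) • θ a := rfl
    simp only [hsmul, map_smul, smul_apply, ← Finset.smul_sum, inner_smul_right,
      Complex.re_ofReal_mul, norm_mul, Complex.norm_real, Real.norm_of_nonneg t.2]
    rw [mul_left_comm]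
    exact mul_le_mul_of_nonneg_left hθ t.2

theorem norm_inner_sum_le_of_mem_closure_coeffCone {θ : A → A}
    (hθ : θ ∈ closure (X.coeffCone : Set (A → A))) {n : ℕ} (q : Fin n → A × C) (h : σ.H) :
    ‖inner ℂ h (∑ i, σ.σA (θ (q i).1) (σ.σC (q i).2 h))‖
      ≤ ‖(inducedPair X σ).rep (∑ i, tmul (q i).1 (q i).2)‖
        * (inner ℂ h (σ.σA (θ 1) h)).re := by
  have hclosed : IsClosed {θ : A → A | ‖inner ℂ h (∑ i, σ.σA (θ (q i).1) (σ.σC (q i).2 h))‖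
      ≤ ‖(inducedPair X σ).rep (∑ i, tmul (q i).1 (q i).2)‖ * (inner ℂ h (σ.σA (θ 1) h)).re} :=
    isClosed_le (by fun_prop) (by fun_prop)
  exact closure_minimal (fun θ hθ => norm_inner_sum_le_of_mem_coeffCone σ hθ q h) hclosed hθ

theorem norm_inner_rep_le (hid : id ∈ closure (X.coeffCone : Set (A → A)))
    (z : MaxTensor A C) (h : σ.H) :
    ‖inner ℂ h (σ.rep z h)‖ ≤ ‖(inducedPair X σ).rep z‖ * (inner ℂ h (σ.σA 1 h)).re := by
  refine denseRange_sum_tmul.induction_on z ?_ fun ⟨n, q⟩ => ?_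
  · exact isClosed_le (by fun_prop) (by fun_prop)
  · have hrep : σ.rep (∑ i, tmul (q i).1 (q i).2) h = ∑ i, σ.σA (q i).1 (σ.σC (q i).2 h) := by
      simp only [map_sum, sum_apply, CommPair.rep_tmul, mul_apply_eq_comp]
    rw [hrep]
    exact norm_inner_sum_le_of_mem_closure_coeffCone σ hid q h

theorem UFP.of_id_mem_closure_coeffCone (hid : id ∈ closure (X.coeffCone : Set (A → A))) :
    UFP X := fun C _ σ _ z hz => by
  refine ContinuousLinearMap.coe_injective ((inner_map_self_eq_zero _).1 fun h => ?_)
  rw [← inner_conj_symm]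
  have hle := norm_inner_rep_le σ hid z h
  rw [hz, norm_zero, zero_mul, norm_le_zero_iff] at hle
  exact (congrArg _ hle).trans (map_zero _)

end Coefficients

/-! ### Weak containment and order -/

section Order

variable {D : Type*} [NonUnitalCStarAlgebra D]
  {H : Type*} [NormedAddCommGroup H] [InnerProductSpace ℂ H] [CompleteSpace H]
  {K : Type*} [NormedAddCommGroup K] [InnerProductSpace ℂ K] [CompleteSpace K]

theorem map_posPart_eq (π : D →⋆ₙₐ[ℂ] (H →L[ℂ] H)) {s : D} (hs : IsSelfAdjoint s) :
    π s⁺ = (π s)⁺ :=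
  NonUnitalStarAlgHomClass.map_cfcₙ (S := ℂ) π _ _

theorem le_zero_iff_re_inner_nonpos {T : H →L[ℂ] H} (hT : IsSelfAdjoint T) :
    T ≤ 0 ↔ ∀ v, (inner ℂ v (T v)).re ≤ 0 := by
  rw [ContinuousLinearMap.le_def, zero_sub, ContinuousLinearMap.isPositive_def',
    and_iff_right hT.neg]
  refine forall_congr' fun v => ?_
  rw [ContinuousLinearMap.reApplyInnerSelf_apply, neg_apply, inner_neg_left, map_neg,
    neg_nonneg, inner_re_symm]
  rfl

theorem re_inner_add_star (T : H →L[ℂ] H) (v : H) :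
    (inner ℂ v ((T + star T) v)).re = 2 * (inner ℂ v (T v)).re := by
  rw [add_apply, inner_add_right, ContinuousLinearMap.star_eq_adjoint,
    ContinuousLinearMap.adjoint_inner_right, Complex.add_re, ← inner_conj_symm (T v) v,
    Complex.conj_re, two_mul]

variable {π : D →⋆ₙₐ[ℂ] (H →L[ℂ] H)} {ρ : D →⋆ₙₐ[ℂ] (K →L[ℂ] K)}

theorem WeaklyContained.map_nonpos (hπ : WeaklyContained π ρ) {s : D} (hs : IsSelfAdjoint s)
    (hρ : ρ s ≤ 0) : π s ≤ 0 := by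
  rw [← CFC.posPart_eq_zero_iff _ (hs.map ρ), ← map_posPart_eq ρ hs] at hρ
  rw [← CFC.posPart_eq_zero_iff _ (hs.map π), ← map_posPart_eq π hs]
  exact hπ _ hρ

theorem WeaklyContained.re_inner_nonpos (hπ : WeaklyContained π ρ) {w : D}
    (hρ : ∀ v, (inner ℂ v (ρ w v)).re ≤ 0) (h : H) : (inner ℂ h (π w h)).re ≤ 0 := by
  have hs : IsSelfAdjoint (w + star w) := IsSelfAdjoint.add_star_self w
  have key : π (w + star w) ≤ 0 := hπ.map_nonpos hs <|
    (le_zero_iff_re_inner_nonpos (hs.map ρ)).2 fun v => by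
      rw [map_add, map_star, re_inner_add_star]
      linarith [hρ v]
  have hh := (le_zero_iff_re_inner_nonpos (hs.map π)).1 key h
  rw [map_add, map_star, re_inner_add_star] at hh
  linarith

end Order

/-! ### Cyclic representations and positive functionals -/

section Commutant

variable {A : Type u} [CStarAlgebra A] {H : Type u} [NormedAddCommGroup H]
  [InnerProductSpace ℂ H] [CompleteSpace H] (π : A →⋆ₐ[ℂ] (H →L[ℂ] H))

/-- The commutant of a representation; an abbreviation, so that it inherits the instances of
star subalgebras. -/
noncomputable abbrev commutant : StarSubalgebra ℂ (H →L[ℂ] H) :=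
  StarSubalgebra.centralizer ℂ (Set.range π)

instance isClosed_commutant : IsClosed (commutant π : Set (H →L[ℂ] H)) := by
  rw [commutant, StarSubalgebra.coe_centralizer]
  exact Set.isClosed_centralizer _

theorem mem_commutant_iff {T : H →L[ℂ] H} : T ∈ commutant π ↔ ∀ a, Commute (π a) T := by
  rw [StarSubalgebra.mem_centralizer_iff, Set.forall_mem_range]
  refine ⟨fun h a => (h a).1, fun h a => ⟨h a, ?_⟩⟩
  rw [← map_star]
  exact h (star a)

/-- A representation paired with its commutant. -/
noncomputable def commutantPair : CommPair A (commutant π) where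
  H := H
  σA := (π : A →⋆ₙₐ[ℂ] (H →L[ℂ] H))
  σC := ((commutant π).subtype : commutant π →⋆ₙₐ[ℂ] (H →L[ℂ] H))
  commute a T := (mem_commutant_iff π).1 T.2 a

theorem commutantPair_nondegenerate : (commutantPair π).Nondegenerate := by
  refine dense_univ.mono fun h _ => Submodule.subset_span ⟨tmul 1 1, h, ?_⟩
  change h = (π 1 * 1) h
  rw [map_one, mul_one]
  rfl

end Commutant

section RadonNikodym

variable {A : Type*} [CStarAlgebra A] [PartialOrder A] [StarOrderedRing A] {f ω : A →ₚ[ℂ] ℂ}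

/-- The contraction between GNS spaces induced by the identity of `A`, for `f ≤ ω`. -/
noncomputable def gnsContraction (hf : ∀ a, 0 ≤ a → f a ≤ ω a) : ω.GNS →L[ℂ] f.GNS :=
  (((f.toPreGNS.toLinearMap ∘ₗ ω.ofPreGNS.toLinearMap : ω.PreGNS →ₗ[ℂ] f.PreGNS)).mkContinuous 1
    fun x => by
      rw [one_mul, ← sq_le_sq₀ (norm_nonneg _) (norm_nonneg _), ← Complex.real_le_real,
        Complex.ofReal_pow, Complex.ofReal_pow, f.preGNS_norm_sq, ω.preGNS_norm_sq]
      exact hf _ (star_mul_self_nonneg _)).completion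

theorem gnsContraction_coe (hf : ∀ a, 0 ≤ a → f a ≤ ω a) (x : A) :
    gnsContraction hf (ω.toPreGNS x : ω.GNS) = (f.toPreGNS x : f.GNS) := by
  simp [gnsContraction]

theorem gnsStarAlgHom_coe (ω : A →ₚ[ℂ] ℂ) (a x : A) :
    ω.gnsStarAlgHom a (ω.toPreGNS x : ω.GNS) = (ω.toPreGNS (a * x) : ω.GNS) := by
  simp

theorem gnsContraction_comp_gnsStarAlgHom (hf : ∀ a, 0 ≤ a → f a ≤ ω a) (a : A) :
    gnsContraction hf ∘L ω.gnsStarAlgHom a = f.gnsStarAlgHom a ∘L gnsContraction hf := by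
  ext v
  induction v using UniformSpace.Completion.induction_on with
  | hp => exact isClosed_eq (by fun_prop) (by fun_prop)
  | ih v =>
    rw [ContinuousLinearMap.comp_apply, ContinuousLinearMap.comp_apply, ← ω.toPreGNS_ofPreGNS v,
      gnsStarAlgHom_coe, gnsContraction_coe, gnsContraction_coe, gnsStarAlgHom_coe]

/-- The Radon–Nikodym derivative of a positive functional `f` with respect to `ω ≥ f`, as an
operator on the GNS space of `ω`. -/
noncomputable def gnsDerivative (hf : ∀ a, 0 ≤ a → f a ≤ ω a) : ω.GNS →L[ℂ] ω.GNS :=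
  ContinuousLinearMap.adjoint (gnsContraction hf) ∘L gnsContraction hf

theorem inner_gnsDerivative (hf : ∀ a, 0 ≤ a → f a ≤ ω a) (x y : A) :
    inner ℂ (ω.toPreGNS x : ω.GNS) (gnsDerivative hf (ω.toPreGNS y : ω.GNS)) = f (star x * y) := by
  rw [gnsDerivative, ContinuousLinearMap.comp_apply, ContinuousLinearMap.adjoint_inner_right,
    gnsContraction_coe, gnsContraction_coe, UniformSpace.Completion.inner_coe, f.preGNS_inner_def]
  rfl

theorem commute_gnsDerivative (hf : ∀ a, 0 ≤ a → f a ≤ ω a) (a : A) :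
    Commute (ω.gnsStarAlgHom a) (gnsDerivative hf) := by
  have hadj := congrArg ContinuousLinearMap.adjoint (gnsContraction_comp_gnsStarAlgHom hf (star a))
  rw [ContinuousLinearMap.adjoint_comp, ContinuousLinearMap.adjoint_comp,
    ← ContinuousLinearMap.star_eq_adjoint, ← ContinuousLinearMap.star_eq_adjoint, ← map_star,
    ← map_star, star_star] at hadj
  rw [commute_iff_eq, gnsDerivative]
  change (_ ∘L (_ ∘L _)) = (_ ∘L _) ∘L _
  rw [← ContinuousLinearMap.comp_assoc, hadj, ContinuousLinearMap.comp_assoc,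
    ContinuousLinearMap.comp_assoc, gnsContraction_comp_gnsStarAlgHom]

theorem denseRange_gnsStarAlgHom (ω : A →ₚ[ℂ] ℂ) :
    DenseRange fun a => ω.gnsStarAlgHom a (ω.toPreGNS 1 : ω.GNS) := by
  simp only [gnsStarAlgHom_coe, mul_one]
  exact UniformSpace.Completion.denseRange_coe (α := ω.PreGNS)

end RadonNikodym

section Positivity

variable {A : Type u} [CStarAlgebra A] [PartialOrder A] [StarOrderedRing A]
  {X : Corr.{u, u, u} A A} {I : Type*} [Fintype I]

theorem UFP.sum_re_inner_nonpos (hX : UFP X) {C : Type u} [NonUnitalCStarAlgebra C]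
    {σ : CommPair A C} (hσ : σ.Nondegenerate) {Ω : σ.H} (hΩ : DenseRange fun a => σ.σA a Ω)
    (a : I → A) (c : I → C)
    (hneg : ∀ ξ, ∑ i, (inner ℂ Ω (σ.σA (X.coeff ξ (a i)) (σ.σC (c i) Ω))).re ≤ 0) :
    ∑ i, (inner ℂ Ω (σ.σA (a i) (σ.σC (c i) Ω))).re ≤ 0 := by
  have inner_rep (p : CommPair A C) (v : p.H) :
      (inner ℂ v (p.rep (∑ i, tmul (a i) (c i)) v)).re
        = ∑ i, (inner ℂ v (p.σA (a i) (p.σC (c i) v))).re := by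
    simp only [map_sum, sum_apply, inner_sum, Complex.re_sum, CommPair.rep_tmul,
      mul_apply_eq_comp]
  have induced_nonpos (v : (inducedPair X σ).H) :
      (inner ℂ v ((inducedPair X σ).rep (∑ i, tmul (a i) (c i)) v)).re ≤ 0 := by
    refine (denseRange_inducedTmul X σ hΩ).induction_on v
      (isClosed_le (by fun_prop) continuous_const) fun ξ => ?_
    simpa only [inner_rep, inducedPair_σC_tmul, inducedPair_σA_tmul, inner_inducedTmul,
      Corr.coeff]
      using hneg ξ
  rw [← inner_rep]
  exact (hX C σ hσ).re_inner_nonpos induced_nonpos Ω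

theorem UFP.sum_re_nonpos (hX : UFP X) (f : I → A →ₚ[ℂ] ℂ) (a : I → A)
    (hneg : ∀ ξ, ∑ i, (f i (X.coeff ξ (a i))).re ≤ 0) : ∑ i, (f i (a i)).re ≤ 0 := by
  let ω : A →ₚ[ℂ] ℂ := ∑ i, f i
  have hω (b : A) : ω b = ∑ i, f i b :=
    map_sum (⟨⟨fun g => g b, rfl⟩, fun _ _ => rfl⟩ : (A →ₚ[ℂ] ℂ) →+ ℂ) f Finset.univ
  have hle (i : I) (b : A) (hb : 0 ≤ b) : f i b ≤ ω b := by
    rw [hω]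
    exact Finset.single_le_sum (f := fun i => f i b) (fun j _ => (f j).map_nonneg hb)
      (Finset.mem_univ i)
  let T (i : I) : commutant ω.gnsStarAlgHom :=
    ⟨gnsDerivative (hle i), (mem_commutant_iff _).2 (commute_gnsDerivative (hle i))⟩
  let Ω : (commutantPair ω.gnsStarAlgHom).H := (ω.toPreGNS 1 : ω.GNS)
  have inner_T (i : I) (b : A) : inner ℂ Ω ((commutantPair ω.gnsStarAlgHom).σA b
      ((commutantPair ω.gnsStarAlgHom).σC (T i) Ω)) = f i b := by
    change inner ℂ (ω.toPreGNS 1 : ω.GNS) ((ω.gnsStarAlgHom b * gnsDerivative (hle i))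
      (ω.toPreGNS 1 : ω.GNS)) = f i b
    rw [commute_gnsDerivative, mul_apply_eq_comp, gnsStarAlgHom_coe, inner_gnsDerivative,
      star_one, one_mul, mul_one]
  have key := hX.sum_re_inner_nonpos (commutantPair_nondegenerate ω.gnsStarAlgHom) (Ω := Ω)
    (denseRange_gnsStarAlgHom ω) a T
  simp only [inner_T] at key
  exact key hneg

end Positivity

/-! ### Separation by positive functionals and necessity -/

section Separation

open ComplexStarModule

variable {A : Type*} [CStarAlgebra A] [PartialOrder A] [StarOrderedRing A]

variable (A) in
/-- The cone of dissipative elements. Adding it to a cone before separating forces the separating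
functionals to be positive, which replaces a Jordan decomposition. -/
noncomputable def dissipativeCone : PointedCone ℝ A where
  carrier := {d | (ℜ d : A) ≤ 0}
  zero_mem' := by simp
  add_mem' {d e} hd he := by
    simpa only [Set.mem_ofPred_eq, map_add, AddSubgroup.coe_add] using! add_nonpos hd he
  smul_mem' t d hd := by
    have hsmul : (ℜ (t • d) : A) = (t : ℝ) • (ℜ d : A) := by
      rw [← selfAdjoint.val_smul, ← map_smul]
      rfl
    simpa only [Set.mem_ofPred_eq, hsmul] using! smul_nonpos_of_nonneg_of_nonpos t.2 hd

theorem mem_dissipativeCone {d : A} : d ∈ dissipativeCone A ↔ (ℜ d : A) ≤ 0 := Iff.rfl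

theorem smul_mem_dissipativeCone {p : A} (hp : 0 ≤ p) {z : ℂ} (hz : z.re ≤ 0) :
    z • p ∈ dissipativeCone A := by
  have hre : (ℜ (z • p) : A) = z.re • p := by
    rw [realPart_smul, (IsSelfAdjoint.of_nonneg hp).imaginaryPart, smul_zero, sub_zero,
      selfAdjoint.val_smul, (IsSelfAdjoint.of_nonneg hp).coe_realPart]
  rw [mem_dissipativeCone, hre]
  exact smul_nonpos_of_nonpos_of_nonneg hz hp

theorem exists_positiveLinearMap_re_eq (g : StrongDual ℝ A)
    (hg : ∀ d ∈ dissipativeCone A, g d ≤ 0) : ∃ f : A →ₚ[ℂ] ℂ, ∀ a, (f a).re = g a := by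
  have re_eq (a : A) : (g.extendRCLike (𝕜 := ℂ) a).re = g a :=
    StrongDual.re_extendRCLike_apply (𝕜 := ℂ) g a
  refine ⟨PositiveLinearMap.mk₀ (g.extendRCLike (𝕜 := ℂ)).toLinearMap fun p hp => ?_, re_eq⟩
  have hrotate (z : ℂ) (hz : z.re ≤ 0) : (z * g.extendRCLike (𝕜 := ℂ) p).re ≤ 0 := by
    rw [← smul_eq_mul, ← map_smul, re_eq]
    exact hg _ (smul_mem_dissipativeCone hp hz)
  have hre := hrotate (-1) (by simp)
  have him := hrotate Complex.I (by simp)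
  have him' := hrotate (-Complex.I) (by simp)
  simp only [neg_mul, one_mul, Complex.neg_re, Complex.I_mul_re, neg_neg, neg_nonpos]
    at hre him him'
  exact Complex.nonneg_iff.2 ⟨hre, le_antisymm him him'⟩

theorem exists_positive_functionals_of_notMem_closure {I : Type*} [Fintype I]
    (K : PointedCone ℝ (I → A)) {a : I → A}
    (ha : a ∉ closure
      (K ⊔ Submodule.pi Set.univ fun _ => dissipativeCone A : PointedCone ℝ (I → A))) :
    ∃ f : I → A →ₚ[ℂ] ℂ, 0 < ∑ i, (f i (a i)).re ∧ ∀ k ∈ K, ∑ i, (f i (k i)).re ≤ 0 := by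
  classical
  let P : PointedCone ℝ (I → A) := Submodule.pi Set.univ fun _ => dissipativeCone A
  let C : ProperCone ℝ (I → A) := ⟨(K ⊔ P).closure, isClosed_closure⟩
  have hKP : (K ⊔ P : PointedCone ℝ (I → A)) ≤ C.toPointedCone := subset_closure
  obtain ⟨F, hF, hFa⟩ := C.hyperplane_separation_point ha
  let g (i : I) : StrongDual ℝ A := -(F ∘L ContinuousLinearMap.single ℝ (fun _ => A) i)
  have sum_g (b : I → A) : ∑ i, g i (b i) = -F b := by
    simp only [g, neg_apply, ContinuousLinearMap.comp_apply, ContinuousLinearMap.single_apply,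
      Finset.sum_neg_distrib, ← map_sum, Finset.univ_sum_single]
  have hg (i : I) (d : A) (hd : d ∈ dissipativeCone A) : g i d ≤ 0 := by
    have hsingle : Pi.single i d ∈ P := fun j _ => by
      rcases eq_or_ne j i with rfl | hj
      · simpa using hd
      · simp [hj]
    exact neg_nonpos.2 <| hF _ <| hKP <| Submodule.mem_sup_right hsingle
  choose f hf using fun i => exists_positiveLinearMap_re_eq (g i) (hg i)
  have sum_f (b : I → A) : ∑ i, (f i (b i)).re = -F b := by simp only [hf, sum_g]
  refine ⟨f, (sum_f a).symm ▸ neg_pos.2 hFa, fun k hk => (sum_f k).symm ▸ neg_nonpos.2 ?_⟩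
  exact hF k <| hKP <| Submodule.mem_sup_left hk

theorem norm_le_of_le_algebraMap {s : A} (hs : IsSelfAdjoint s) {r : ℝ} (hr : 0 ≤ r)
    (h : s ≤ algebraMap ℝ A r) (h' : -s ≤ algebraMap ℝ A r) : ‖s‖ ≤ r := by
  rcases subsingleton_or_nontrivial A
  · rwa [Subsingleton.elim s 0, norm_zero]
  rcases CStarAlgebra.norm_or_neg_norm_mem_spectrum hs with hmem | hmem
  · exact (le_algebraMap_iff_spectrum_le (ha := hs)).1 h _ hmem
  · refine (le_algebraMap_iff_spectrum_le (ha := hs.neg)).1 h' _ ?_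
    rwa [← spectrum.neg_eq, Set.mem_neg]

theorem realPart_le_of_norm_sub_le {x d : A} (hd : d ∈ dissipativeCone A) {r : ℝ}
    (h : ‖x - d‖ ≤ r) : (ℜ x : A) ≤ algebraMap ℝ A r :=
  calc (ℜ x : A) = ℜ d + ℜ (x - d) := by simp
    _ ≤ ℜ (x - d) := add_le_of_nonpos_left hd
    _ ≤ algebraMap ℝ A ‖(ℜ (x - d) : A)‖ := (ℜ (x - d)).2.le_algebraMap_norm_self
    _ ≤ algebraMap ℝ A r := algebraMap_mono A ((realPart.norm_le _).trans h)

theorem norm_le_of_forall_near_dissipativeCone {x : A} {r : ℝ}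
    (h : ∀ k : Fin 4, ∃ d ∈ dissipativeCone A, ‖Complex.I ^ (k : ℕ) • x - d‖ ≤ r) :
    ‖x‖ ≤ 2 * r := by
  choose d hd hxd using h
  have hr : 0 ≤ r := (norm_nonneg _).trans (hxd 0)
  have rotated_le (k : Fin 4) : (ℜ (Complex.I ^ (k : ℕ) • x) : A) ≤ algebraMap ℝ A r :=
    realPart_le_of_norm_sub_le (hd k) (hxd k)
  have hre : ‖(ℜ x : A)‖ ≤ r := norm_le_of_le_algebraMap (ℜ x).2 hr
    (by simpa using rotated_le 0) (by simpa using rotated_le 2)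
  have him : ‖(ℑ x : A)‖ ≤ r := norm_le_of_le_algebraMap (ℑ x).2 hr
    (by simpa [pow_succ] using rotated_le 3) (by simpa using rotated_le 1)
  calc ‖x‖ = ‖(ℜ x : A) + Complex.I • (ℑ x : A)‖ := by rw [realPart_add_I_smul_imaginaryPart]
    _ ≤ ‖(ℜ x : A)‖ + ‖(ℑ x : A)‖ := by
        simpa [norm_smul] using norm_add_le (ℜ x : A) (Complex.I • (ℑ x : A))
    _ ≤ 2 * r := by linarith

end Separation

section Necessity

variable {A : Type u} [CStarAlgebra A] [PartialOrder A] [StarOrderedRing A]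
  {X : Corr.{u, u, u} A A}

theorem UFP.mem_closure_sup_dissipativeCone (hX : UFP X) {I : Type*} [Finite I] (a : I → A) :
    a ∈ closure (X.coeffCone.map (LinearMap.funLeft ℝ A a) ⊔
      Submodule.pi Set.univ fun _ => dissipativeCone A : PointedCone ℝ (I → A)) := by
  cases nonempty_fintype I
  by_contra ha
  obtain ⟨f, hpos, hneg⟩ := exists_positive_functionals_of_notMem_closure _ ha
  refine hpos.not_ge <| hX.sum_re_nonpos f a fun ξ => hneg (fun i => X.coeff ξ (a i)) ?_
  exact ⟨X.coeff ξ, Submodule.subset_span ⟨ξ, rfl⟩, rfl⟩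

theorem mem_closure_pi_iff_dist {α β : Type*} [PseudoMetricSpace β] {S : Set (α → β)} {f : α → β} :
    f ∈ closure S ↔ ∀ (F : Finset α) (ε : ℝ), 0 < ε → ∃ g ∈ S, ∀ a ∈ F, dist (f a) (g a) < ε := by
  have hbasis : (nhds f).HasBasis (fun q : Set α × ℝ => q.1.Finite ∧ 0 < q.2)
      fun q => q.1.pi fun a => Metric.ball (f a) q.2 := by
    rw [nhds_pi]
    refine Filter.hasBasis_pi_same_index (fun a => Metric.nhds_basis_ball) fun F r hF hr => ?_
    have small_near_zero : ∀ᶠ ε in nhdsWithin (0 : ℝ) (Set.Ioi 0), ∀ a ∈ F, ε ∈ Set.Ioo 0 (r a) :=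
      (Filter.eventually_all_finite hF).2 fun a ha => Ioo_mem_nhdsGT (hr a ha)
    obtain ⟨ε, hε, hεr⟩ := (eventually_mem_nhdsWithin.and small_near_zero).exists
    exact ⟨ε, hε, fun a ha => Metric.ball_subset_ball (hεr a ha).2.le⟩
  rw [mem_closure_iff_nhds_basis hbasis]
  refine ⟨fun h F ε hε => ?_, fun h ⟨F, ε⟩ ⟨hF, hε⟩ => ?_⟩
  · obtain ⟨g, hg, hfg⟩ := h (F, ε) ⟨F.finite_toSet, hε⟩
    exact ⟨g, hg, fun a ha => Metric.mem_ball'.1 (hfg a ha)⟩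
  · obtain ⟨g, hg, hfg⟩ := h hF.toFinset ε hε
    exact ⟨g, hg, fun a ha => Metric.mem_ball'.2 (hfg a (hF.mem_toFinset.2 ha))⟩

theorem UFP.exists_norm_sub_dissipative_lt (hX : UFP X) {I : Type*} [Finite I] (a : I → A)
    {ε : ℝ} (hε : 0 < ε) :
    ∃ θ ∈ X.coeffCone, ∀ i, ∃ d ∈ dissipativeCone A, ‖a i - θ (a i) - d‖ < ε := by
  cases nonempty_fintype I
  obtain ⟨y, hy, hay⟩ := Metric.mem_closure_iff.1 (hX.mem_closure_sup_dissipativeCone a) ε hε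
  obtain ⟨_, ⟨θ, hθ, rfl⟩, d, hd, rfl⟩ := Submodule.mem_sup.1 hy
  refine ⟨θ, hθ, fun i => ⟨d i, hd i trivial, ?_⟩⟩
  rw [sub_sub, ← dist_eq_norm]
  exact (dist_le_pi_dist a _ i).trans_lt hay

theorem UFP.id_mem_closure_coeffCone (hX : UFP X) : id ∈ closure (X.coeffCone : Set (A → A)) := by
  refine mem_closure_pi_iff_dist.2 fun F ε hε => ?_
  obtain ⟨θ, hθ, hnear⟩ := hX.exists_norm_sub_dissipative_lt
    (fun j : F × Fin 4 => Complex.I ^ (j.2 : ℕ) • (j.1 : A)) (by positivity : 0 < ε / 3)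
  refine ⟨θ, hθ, fun a ha => ?_⟩
  have hle : ‖a - θ a‖ ≤ 2 * (ε / 3) := norm_le_of_forall_near_dissipativeCone fun k => by
    obtain ⟨d, hd, hlt⟩ := hnear (⟨a, ha⟩, k)
    rw [Corr.map_smul_of_mem_coeffCone hθ, ← smul_sub] at hlt
    exact ⟨d, hd, hlt.le⟩
  rw [id, dist_eq_norm]
  linarith

theorem ufp_iff_id_mem_closure_coeffCone : UFP X ↔ id ∈ closure (X.coeffCone : Set (A → A)) :=
  ⟨UFP.id_mem_closure_coeffCone, UFP.of_id_mem_closure_coeffCone⟩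

end Necessity

/-! ### Coefficients of interior tensor products -/

section TensorCoefficients

variable {A B : Type u} [CStarAlgebra A] [PartialOrder A] [StarOrderedRing A]
  [CStarAlgebra B] [PartialOrder B] [StarOrderedRing B]

theorem HilbertModule.continuous_ip (X : HilbertModule B) :
    Continuous fun p : X.carrier × X.carrier => X.ip p.1 p.2 :=
  let ipCLM : X.carrier →L⋆[ℂ] X.carrier →L[ℂ] B :=
    X.ip.mkContinuous₂ 1 fun x y => (X.norm_ip_le x y).trans_eq (by rw [one_mul])
  (ipCLM.continuous.comp continuous_fst).clm_apply continuous_snd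

theorem Corr.continuous_coeff (X : Corr.{u, u, u} A A) : Continuous X.coeff :=
  continuous_pi fun a => X.continuous_ip.comp (continuous_id.prodMk (X.left a).continuous)

variable (X : Corr.{u, u, u} A B) (Y : Corr.{u, u, u} B A)

theorem Corr.coeff_sum_tmul {n : ℕ} (ξ : Fin n → X.carrier) (η : Fin n → Y.carrier) (a : A) :
    (X.tensor Y).coeff (∑ i, X.tmul Y (ξ i) (η i)) a = Y.rowSum η (X.compress ξ a) := by
  simp only [Corr.coeff, map_sum, LinearMap.sum_apply, X.left_tmul, X.ip_tmul]
  exact Finset.sum_comm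

/-- The map `∑ₖ ψₖ ∘ φₖ`, where `φₖ` and `ψₖ` are the completely positive maps given by the vectors
`ξ k` of `X` and `η k` of `Y`. -/
noncomputable def Corr.factorMap {n m : ℕ} (ξ : Fin m → Fin n → X.carrier)
    (η : Fin m → Fin n → Y.carrier) (a : A) : A :=
  ∑ k, Y.rowSum (η k) (X.compress (ξ k) a)

theorem Corr.factorMap_eq_sum_coeff {n m : ℕ} (ξ : Fin m → Fin n → X.carrier)
    (η : Fin m → Fin n → Y.carrier) :
    X.factorMap Y ξ η = ∑ k, (X.tensor Y).coeff (∑ i, X.tmul Y (ξ k i) (η k i)) := by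
  ext a
  simp only [Finset.sum_apply, Corr.coeff_sum_tmul, Corr.factorMap]

variable {V : Type*} [AddCommGroup V] [Module ℂ V] (f : V →ₗ[ℂ] X.carrier)

/-- The finite sums `∑ f xᵢ ⊗ yᵢ` in `X ⊗_B Y`. -/
def Corr.tmulSums : Set (X.tensor Y).carrier :=
  {v | ∃ (n : ℕ) (x : Fin n → V) (y : Fin n → Y.carrier), ∑ i, X.tmul Y (f (x i)) (y i) = v}

variable {f} in
theorem Corr.dense_tmulSums (hf : DenseRange f) : Dense (X.tmulSums Y f) := by
  let P := Submodule.span ℂ (Set.range fun p : V × Y.carrier => X.tmul Y (f p.1) p.2)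
  have hP : IsClosed (P.topologicalClosure : Set (X.tensor Y).carrier) :=
    P.isClosed_topologicalClosure
  have P_le : (P : Set (X.tensor Y).carrier) ⊆ X.tmulSums Y f := fun v hv => by
    obtain ⟨n, c, g, rfl⟩ := Submodule.mem_span_set'.1 hv
    choose p hp using fun i => (g i).2
    exact ⟨n, fun i => c i • (p i).1, fun i => (p i).2, by simp [← hp]⟩
  refine fun v => closure_mono P_le <| X.mem_of_tmul_mem Y hP (fun ξ y => ?_) v
  refine hf.induction_on (p := fun ξ => X.tmul Y ξ y ∈ P.topologicalClosure) ξ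
    (hP.preimage ((X.tmul Y).flip y).continuous) fun x => ?_
  exact P.le_topologicalClosure (Submodule.subset_span ⟨(x, y), rfl⟩)

/-- The maps `∑ₖ ψₖ ∘ φₖ` given by vectors in the range of `f` and vectors of `Y`. -/
def Corr.factorMaps : Set (A → A) :=
  {θ | ∃ (n m : ℕ) (x : Fin m → Fin n → V) (y : Fin m → Fin n → Y.carrier),
    X.factorMap Y (fun k i => f (x k i)) y = θ}

theorem Corr.factorMaps_subset_coeffCone :
    X.factorMaps Y f ⊆ ((X.tensor Y).coeffCone : Set (A → A)) := by
  rintro _ ⟨n, m, x, y, rfl⟩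
  rw [Corr.factorMap_eq_sum_coeff]
  exact sum_mem fun k _ => Submodule.subset_span ⟨_, rfl⟩

theorem Corr.hull_coeff_tmulSums_subset_factorMaps :
    (PointedCone.hull ℝ ((X.tensor Y).coeff '' X.tmulSums Y f) : Set (A → A)) ⊆
      X.factorMaps Y f := fun θ hθ => by
  simp only [Corr.factorMaps, Corr.factorMap_eq_sum_coeff]
  induction hθ using Submodule.span_induction with
  | mem θ hθ =>
    obtain ⟨_, ⟨n, x, y, rfl⟩, rfl⟩ := hθ
    exact ⟨n, 1, fun _ => x, fun _ => y, by simp⟩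
  | zero => exact ⟨0, 0, 0, 0, by simp⟩
  | add θ θ' _ _ hθ hθ' =>
    obtain ⟨n, m, x, y, rfl⟩ := hθ
    obtain ⟨n', m', x', y', rfl⟩ := hθ'
    exact ⟨n + n', m + m',
      Fin.append (fun k => Fin.append (x k) 0) (fun k => Fin.append 0 (x' k)),
      Fin.append (fun k => Fin.append (y k) 0) (fun k => Fin.append 0 (y' k)),
      by simp [Fin.sum_univ_add]⟩
  | smul t θ _ hθ =>
    obtain ⟨n, m, x, y, rfl⟩ := hθ
    refine ⟨n, m, x, fun k i => ((√t : ℝ) : ℂ) • y k i, ?_⟩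
    simp only [map_smul, ← Finset.smul_sum, Corr.coeff_smul, Complex.norm_real,
      Real.norm_of_nonneg (Real.sqrt_nonneg _), Real.sq_sqrt t.2]
    rfl

variable {f}

theorem Corr.closure_factorMaps (hf : DenseRange f) :
    closure (X.factorMaps Y f) = closure ((X.tensor Y).coeffCone : Set (A → A)) := by
  refine (closure_mono (X.factorMaps_subset_coeffCone Y f)).antisymm <|
    closure_minimal ?_ isClosed_closure
  let K := PointedCone.hull ℝ ((X.tensor Y).coeff '' X.tmulSums Y f)
  have coeffCone_le : (X.tensor Y).coeffCone ≤ Submodule.topologicalClosure K := by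
    refine Submodule.span_le.2 ?_
    rintro _ ⟨ξ, rfl⟩
    exact map_mem_closure (X.tensor Y).continuous_coeff (X.dense_tmulSums Y hf ξ)
      fun ξ hξ => Submodule.subset_span ⟨ξ, hξ, rfl⟩
  exact Set.Subset.trans coeffCone_le <|
    closure_mono (X.hull_coeff_tmulSums_subset_factorMaps Y f)

theorem Corr.ufp_tensor_iff (hf : DenseRange f) :
    UFP (X.tensor Y) ↔ ∀ (F : Finset A) (ε : ℝ), 0 < ε →
      ∃ (n m : ℕ) (x : Fin m → Fin n → V) (y : Fin m → Fin n → Y.carrier),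
        ∀ a ∈ F, ‖a - X.factorMap Y (fun k i => f (x k i)) y a‖ < ε := by
  rw [ufp_iff_id_mem_closure_coeffCone, ← X.closure_factorMaps Y hf, mem_closure_pi_iff_dist]
  refine forall₃_congr fun F ε _ => ⟨?_, ?_⟩
  · rintro ⟨_, ⟨n, m, x, y, rfl⟩, hF⟩
    exact ⟨n, m, x, y, fun a ha => (dist_eq_norm a _).symm.trans_lt (hF a ha)⟩
  · rintro ⟨n, m, x, y, hF⟩
    exact ⟨_, ⟨n, m, x, y, rfl⟩, fun a ha => (dist_eq_norm a _).trans_lt (hF a ha)⟩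

end TensorCoefficients

section CondExp

variable {A B : Type u} [CStarAlgebra A] [PartialOrder A] [StarOrderedRing A]
  [CStarAlgebra B] [PartialOrder B] [StarOrderedRing B] {ι : B →⋆ₐ[ℂ] A} (E : CondExp ι)

/-- The canonical map from `A` to `L²(A, E)`. -/
noncomputable def CondExp.toL2 : A →ₗ[ℂ] E.L2.carrier := E.semi.incl

theorem CondExp.denseRange_toL2 : DenseRange E.toL2 := E.semi.denseRange_incl

theorem CondExp.ip_toL2 (x y : A) :
    E.L2.ip (E.toL2 x) (E.toL2 y) = E.toLinearMap (star x * y) :=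
  E.semi.ipHat_incl x y

theorem CondExp.left_toL2 (a x : A) : E.L2.left a (E.toL2 x) = E.toL2 (a * x) :=
  E.semi.rep_incl (NonUnitalAlgHom.lmul ℂ A) (fun a x y => by
    change E.toLinearMap (star (star a * x) * y) = E.toLinearMap (star x * (a * y))
    rw [star_mul, star_star, mul_assoc]) a x

theorem CondExp.compress_toL2 {n : ℕ} (x : Fin n → A) (a : A) :
    E.L2.compress (fun i => E.toL2 (x i)) a =
      CStarMatrix.ofMatrix fun i j => E.toLinearMap (star (x i) * a * x j) := by
  ext i j
  change E.L2.ip (E.toL2 (x i)) (E.L2.left a (E.toL2 (x j))) = E.toLinearMap (star (x i) * a * x j)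
  rw [E.left_toL2, E.ip_toL2, mul_assoc]

theorem algCorr_rowSum (ι : B →⋆ₐ[ℂ] A) {n : ℕ} (y : Fin n → A)
    (b : CStarMatrix (Fin n) (Fin n) B) :
    (algCorr ι).rowSum y b = ∑ i, ∑ j, star (y i) * ι (b i j) * y j := by
  simp only [mul_assoc]
  rfl

end CondExp

end RelNuc

theorem theoremA {A B : Type u} [CStarAlgebra A] [PartialOrder A] [StarOrderedRing A]
    [CStarAlgebra B] [PartialOrder B] [StarOrderedRing B]
    (ι : B →⋆ₐ[ℂ] A) (E : RelNuc.CondExp ι) :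
    E.IsNuclear ↔
      ∀ (F : Finset A) (ε : ℝ), 0 < ε →
        ∃ (n m : ℕ) (φ : Fin m → (A →CP CStarMatrix (Fin n) (Fin n) B))
          (ψ : Fin m → (CStarMatrix (Fin n) (Fin n) B →CP A)),
          (∀ a ∈ F, ‖a - ∑ k, ψ k (φ k a)‖ < ε) ∧
          ∀ k, ∃ x y : Fin n → A,
            (∀ a, φ k a =
              CStarMatrix.ofMatrix fun i j => E.toLinearMap (star (x i) * a * x j)) ∧
            (∀ b, ψ k b = ∑ i, ∑ j, star (y i) * ι (b i j) * y j) := by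
  refine (E.L2.ufp_tensor_iff (RelNuc.algCorr ι) E.denseRange_toL2).trans <|
    forall₃_congr fun F ε _ => ⟨?_, ?_⟩
  · rintro ⟨n, m, x, y, hF⟩
    exact ⟨n, m, fun k => E.L2.compress fun i => E.toL2 (x k i),
      fun k => (RelNuc.algCorr ι).rowSum (y k), hF,
      fun k => ⟨x k, y k, E.compress_toL2 (x k), RelNuc.algCorr_rowSum ι (y k)⟩⟩
  · rintro ⟨n, m, φ, ψ, hF, hφψ⟩
    choose x y hφ hψ using hφψ
    refine ⟨n, m, x, y, fun a ha => ?_⟩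
    simpa only [RelNuc.Corr.factorMap, E.compress_toL2, RelNuc.algCorr_rowSum, hφ, hψ] using hF a ha
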